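/- For complex numbers $x,q$ and an integer $k\ge 0$ put $(x;q)_k=\prod_{s=0}^{k-1}(1-xq^s)$ (so $(x;q)_0=1$), and write $$\left[\begin{matrix}x_1,\dots,x_r\\ y_1,\dots,y_s\end{matrix}\,\Big|\,q\right]_k=\frac{(x_1;q)_k\cdots(x_r;q)_k}{(y_1;q)_k\cdots(y_s;q)_k},\qquad {}_4\phi_3\!\left[\begin{matrix}a_0,a_1,a_2,a_3\\ b_1,b_2,b_3\end{matrix};q,z\right]=\sum_{k=0}^{\infty}\left[\begin{matrix}a_0,a_1,a_2,a_3\\ q,b_1,b_2,b_3\end{matrix}\,\Big|\,q\right]_k z^k .$$ Let $\ell,m,n$ be nonnegative integers and let $q,a,c$ be nonzero complex numbers such that no denominator occurring in the formula below vanishes (in the series on the left, which terminates, only the terms with $0\le k\le n$ matter; terms with $k>n$ are $0$). Then $$ \begin{aligned} &{}_4\phi_3\!\left[\begin{matrix}a,\ c,\ q^{-n},\ -q^{1+\ell+m+n}a/c\\ q^{1+\ell}a/c,\ q^{1+m+n}a,\ -q^{-n}c\end{matrix};q,q\right] =\left[\begin{matrix}a,\ -q^{-\ell}c\\ q^{-\ell-1}c^2,\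 -qa/c\end{matrix}\,\Big|\,q\right]_{\ell} \left[\begin{matrix}q^{1+m+n},\ -qa/c\\ q^{1+m+n}a,\ -q/c\end{matrix}\,\Big|\,q\right]_{n}\\ &\times\sum_{i=0}^{\ell}\sum_{j=0}^{m}(-1)^{i+j}q^{\binom{j+1}{2}-nj}\Big(\frac{c}{a}\Big)^{i}\,\frac{1-q^{1+2i}/c^2}{1-q/c^2} \left[\begin{matrix}q^{-\ell},\ q^{1+\ell}a/c^2,\ q/c^2\\ q,\ q^{1-\ell}/a,\ q^{2+\ell}/c^2\end{matrix}\,\Big|\,q\right]_{i}\\ &\times\left[\begin{matrix}q^{-m},\ q^{-m-n},\ -q^{-m-n},\ q^{\ell-i}a,\ q^{1+\ell+i}a/c^2\\ q,\ q^{1+\ell}a/c,\ -q^{1+\ell}a/c,\ q^{-m-2n},\ q^{j-2m-2n-1}\end{matrix}\,\Big|\,q\right]_{j} \left[\begin{matrix}q^{1+\ell-i+j}a,\ q^{2+\ell+i+j}a/c^2\\ q,\ q^{2+2\ell+2j}a^2/c^2\end{matrix}\,\Big|\,q^2\right]_{m+n-j}. \end{aligned} $$ -/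

import Mathlib

/-- The `q`-shifted factorial `(x; q)_n = ∏_{k=0}^{n-1} (1 - x q^k)`, with `(x; q)_0 = 1`. -/
noncomputable def qShifted (x q : ℂ) (n : ℕ) : ℂ :=
  ∏ k ∈ Finset.range n, (1 - x * q ^ k)

/-- The fraction `[num; den | q]_n`: the product of the `(x; q)_n` for `x` in the first list over
the product of the `(y; q)_n` for `y` in the second list. -/
noncomputable def qFrac (num den : List ℂ) (q : ℂ) (n : ℕ) : ℂ :=
  (num.map fun x => qShifted x q n).prod / (den.map fun y => qShifted y q n).prod

/-- The basic hypergeometric series with numerator parameters `num`, denominator parameters `den`,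
base `q` and argument `z`: the sum over all `k ≥ 0` of `[num; q, den | q]_k z^k`. If some numerator
parameter is `q^{-n}` with `q ≠ 0`, the terms with `k > n` vanish, so the sum is finite. -/
noncomputable def qHypergeometric (num den : List ℂ) (q z : ℂ) : ℂ :=
  ∑' k : ℕ, qFrac num (q :: den) q k * z ^ k

/-!
The idea: both sides are built from the series with `l = m = 0`, which has a closed form, by contiguous
relations, and the double sum records the iteration of these relations.

The series is balanced: the product of its denominator parameters is `q` times the product of its
numerator parameters. Balanced series satisfy three-term contiguous relations whose coefficients
factor completely; `sum_phiTerm_contiguous` is the one that relates `φ` to the series with `A, E`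
replaced by `qA, qE` and the series with `C, G` replaced by `C/q, G/q`. It holds because the
corresponding combination of terms telescopes. With two choices of the distinguished pairs it expresses
the series for `l + 1` through those for `l` with parameters `(qa, c)` and `(a, c/q)`
(`series_l_succ`), and, for `l = 0`, the series for `(m + 1, n)` through those for `(m, n)` with
parameters `(qa, c)` and for `(m, n + 1)` (`series_m_succ`).

Iterating a relation with two such branches yields a sum over `i + s = l` (respectively `j + s = m`)
whose coefficients satisfy a Pascal type recurrence. The coefficients `lCoef` and `mCoef` do satisfy
it: for both, the two contributions relative to the new coefficient are explicit rational functions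
of powers of `q` that add up to `1`. This gives `series_expand` and `series_zero_left`. The remaining
series with `l = m = 0` satisfies a first-order recurrence in `n` (`series_n_succ`), again by
telescoping, and this determines its sum (`series_zero_zero`).

The intermediate steps divide by factors that the hypotheses of the theorem do not control, so all
this is carried out for multiplicatively independent `q`, `a`, `c` (`Generic`). Such triples are
dense (`frequently_generic`), and both sides of the identity are continuous at every triple where no
denominator vanishes, hence the identity extends.
-/

/-! ### Shifted factorials -/

lemma qShifted_zero (x q : ℂ) : qShifted x q 0 = 1 := by simp [qShifted]

lemma qShifted_succ (x q : ℂ) (k : ℕ) :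
    qShifted x q (k + 1) = qShifted x q k * (1 - x * q ^ k) := by
  simp [qShifted, Finset.prod_range_succ]

lemma qShifted_succ' (x q : ℂ) (k : ℕ) :
    qShifted x q (k + 1) = (1 - x) * qShifted (q * x) q k := by
  simp only [qShifted, Finset.prod_range_succ']
  rw [mul_comm]
  congr 1
  · simp
  · exact Finset.prod_congr rfl fun i _ => by ring

lemma qShifted_add (x q : ℂ) (j k : ℕ) :
    qShifted x q (j + k) = qShifted x q j * qShifted (q ^ j * x) q k := by
  simp only [qShifted, Finset.prod_range_add]
  congr 1
  exact Finset.prod_congr rfl fun i _ => by ring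

lemma qShifted_ne_zero {x q : ℂ} (h : ∀ k : ℕ, 1 - x * q ^ k ≠ 0) (k : ℕ) :
    qShifted x q k ≠ 0 := Finset.prod_ne_zero_iff.2 fun i _ => h i

/-- Reversal of the order of the factors: the last `i` factors of `(x; q)_{s+i}`, each divided by
its leading monomial, are those of `(y; q)_i` for the `y` with `x y = q ^ (1 - s - i)`. -/
lemma qShifted_reverse {x y q : ℂ} (i : ℕ) :
    ∀ s : ℕ, y * x * q ^ (s + i) = q → q ≠ 0 →
      qShifted y q i * qShifted x q s = (-y) ^ i * q ^ i.choose 2 * qShifted x q (s + i) := by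
  induction i with
  | zero => intro s _ _; simp [qShifted_zero]
  | succ i ih =>
    intro s h hq
    have h1 := ih (s + 1) (by linear_combination h) hq
    rw [qShifted_succ x q s] at h1
    have h2 : y * q ^ i * (x * q ^ s) = 1 := by
      apply mul_right_cancel₀ hq
      linear_combination h
    rw [qShifted_succ, show s + (i + 1) = s + 1 + i by ring, Nat.choose_succ_succ' i 1,
      Nat.choose_one_right, pow_succ, pow_add]
    linear_combination (-y * q ^ i) * h1 - qShifted y q i * qShifted x q s * h2

/-! ### The contiguous relation for balanced series -/

/-- The `k`-th term of the series `₄φ₃[A, B, C, D; E, F, G; q, q]`. -/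
noncomputable def phiTerm (q A B C D E F G : ℂ) (k : ℕ) : ℂ :=
  qShifted A q k * qShifted B q k * qShifted C q k * qShifted D q k /
    (qShifted q q k * qShifted E q k * qShifted F q k * qShifted G q k) * q ^ k

/-- The polynomial identity behind `sum_phiTerm_contiguous`; `x` is `q ^ k`. -/
lemma contiguous_identity {q A B C D E F G x : ℂ} (hq : q ≠ 0) (hA : A ≠ 0) (hC : C ≠ 0)
    (hE : E ≠ 0) (bal : q * A * B * C * D = E * F * G) :
    (1 - E * (q * x)) * (1 - C * x) * q * x * (G / q - A) * (1 - F / (A * C))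
      + (E - B) * (1 - D / E) * (1 - A * (q * x)) * (1 - C * x) * q * x
      + (1 - F / C) * (1 - C / q) * (1 - G * x) * (1 - E * (q * x)) * q * x
    = (1 - A * (q * x)) * (1 - B * (q * x)) * (1 - C * x) * (1 - D * (q * x))
      - (1 - q * x) * (1 - F * x) * (1 - G * x) * (1 - E * (q * x)) := by
  field_simp
  linear_combination x * (1 - E * (q * x)) * (1 - C * x) * (1 - A * (q * x)) * bal

/-- The contiguous relation between a balanced series, the one with `A, E` replaced by `qA, qE`,
and the one with `C, G` replaced by `C/q, G/q`. The left-hand side is a telescoping sum, hence its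
partial sums are explicit products; they vanish beyond the point where the series terminate. -/
lemma sum_phiTerm_contiguous {q A B C D E F G : ℂ} (hq : q ≠ 0) (hA : A ≠ 0) (hC : C ≠ 0)
    (hE : E ≠ 0) (hA1 : 1 - A ≠ 0)
    (hqq : ∀ k : ℕ, 1 - q * q ^ k ≠ 0) (hEk : ∀ k : ℕ, 1 - E * q ^ k ≠ 0)
    (hFk : ∀ k : ℕ, 1 - F * q ^ k ≠ 0) (hGk : ∀ k : ℕ, 1 - G * q ^ k ≠ 0) (hG1 : 1 - G / q ≠ 0)
    (bal : q * A * B * C * D = E * F * G) (N : ℕ) :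
    (G / q - A) * (1 - F / (A * C)) * ∑ k ∈ Finset.range (N + 1), phiTerm q A B C D E F G k
      + (E - B) * (1 - D / E) * ((1 - A) / (1 - E)) *
        ∑ k ∈ Finset.range (N + 1), phiTerm q (q * A) B C D (q * E) F G k
      + (1 - F / C) * (1 - G / q) *
        ∑ k ∈ Finset.range (N + 1), phiTerm q A B (C / q) D E F (G / q) k
    = qShifted A q (N + 1) * qShifted B q (N + 1) * qShifted C q N * qShifted D q (N + 1) /
      (qShifted q q N * qShifted E q (N + 1) * qShifted F q N * qShifted G q N) := by
  have hE0 : 1 - E ≠ 0 := by simpa using hEk 0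
  induction N with
  | zero =>
    simp only [zero_add, Finset.sum_range_one, phiTerm, qShifted_succ, qShifted_zero]
    simp only [pow_zero, mul_one, one_mul, div_one]
    field_simp
    linear_combination (1 - E) * (1 - A) * bal
  | succ N ih =>
    simp only [Finset.sum_range_succ _ (N + 1), mul_add]
    generalize ∑ k ∈ Finset.range (N + 1), phiTerm q A B C D E F G k = s0 at *
    generalize ∑ k ∈ Finset.range (N + 1), phiTerm q (q * A) B C D (q * E) F G k = s1 at *
    generalize ∑ k ∈ Finset.range (N + 1), phiTerm q A B (C / q) D E F (G / q) k = s2 at *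
    have key := contiguous_identity (x := q ^ N) hq hA hC hE bal
    have e1 : qShifted (q * A) q (N + 1) =
        qShifted A q (N + 1) * (1 - A * q ^ (N + 1)) / (1 - A) := by
      rw [eq_div_iff hA1, ← qShifted_succ, qShifted_succ' A q (N + 1)]; ring
    have e2 : qShifted (q * E) q (N + 1) =
        qShifted E q (N + 1) * (1 - E * q ^ (N + 1)) / (1 - E) := by
      rw [eq_div_iff hE0, ← qShifted_succ, qShifted_succ' E q (N + 1)]; ring
    have e3 : qShifted (C / q) q (N + 1) = (1 - C / q) * qShifted C q N := by
      rw [qShifted_succ', mul_div_cancel₀ _ hq]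
    have e4 : qShifted (G / q) q (N + 1) = (1 - G / q) * qShifted G q N := by
      rw [qShifted_succ', mul_div_cancel₀ _ hq]
    have n1 := qShifted_ne_zero hqq N
    have n2 := qShifted_ne_zero hEk (N + 1)
    have n3 := qShifted_ne_zero hFk N
    have n4 := qShifted_ne_zero hGk N
    have m1 := hqq N
    have m2 := hEk (N + 1)
    have m3 := hFk N
    have m4 := hGk N
    have m2' : 1 - E * (q * q ^ N) ≠ 0 := by rwa [← pow_succ']
    simp only [phiTerm, e1, e2, e3, e4, qShifted_succ A q (N + 1), qShifted_succ B q (N + 1),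
      qShifted_succ D q (N + 1), qShifted_succ E q (N + 1), qShifted_succ C q N,
      qShifted_succ q q N, qShifted_succ F q N, qShifted_succ G q N]
    rw [pow_succ' q N]
    clear e1 e2 e3 e4 m2 hqq hEk hFk hGk
    generalize qShifted A q (N + 1) = sA at *
    generalize qShifted B q (N + 1) = sB at *
    generalize qShifted C q N = sC at *
    generalize qShifted D q (N + 1) = sD at *
    generalize qShifted q q N = sq at *
    generalize qShifted E q (N + 1) = sE at *
    generalize qShifted F q N = sF at *
    generalize qShifted G q N = sG at *
    generalize q ^ N = x at *
    -- the common factor of the new terms and of the two products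
    have hZ : ∃ Z : ℂ, Z = sA * sB * sC * sD /
      (sq * (1 - q * x) * (sE * (1 - E * (q * x))) * (sF * (1 - F * x)) * (sG * (1 - G * x))) :=
      ⟨_, rfl⟩
    obtain ⟨Z, hZ⟩ := hZ
    have h0 : sA * sB * sC * sD / (sq * sE * sF * sG) =
        Z * ((1 - q * x) * (1 - F * x) * (1 - G * x) * (1 - E * (q * x))) := by
      rw [hZ, div_mul_eq_mul_div, div_eq_div_iff (by positivity) (by positivity)]; ring
    have t0 : sA * sB * (sC * (1 - C * x)) * sD / (sq * (1 - q * x) * sE * (sF * (1 - F * x)) *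
        (sG * (1 - G * x))) * (q * x) = Z * ((1 - E * (q * x)) * (1 - C * x) * q * x) := by
      rw [hZ, div_mul_eq_mul_div, div_mul_eq_mul_div,
        div_eq_div_iff (by positivity) (by positivity)]; ring
    have t1 : (1 - A) / (1 - E) * (sA * (1 - A * (q * x)) / (1 - A) * sB * (sC * (1 - C * x)) * sD /
        (sq * (1 - q * x) * (sE * (1 - E * (q * x)) / (1 - E)) * (sF * (1 - F * x)) *
        (sG * (1 - G * x))) * (q * x)) = Z * ((1 - A * (q * x)) * (1 - C * x) * q * x) := by
      have hu : (1 - A) * (sA * (1 - A * (q * x)) / (1 - A)) = sA * (1 - A * (q * x)) :=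
        mul_div_cancel₀ _ hA1
      have hv : (1 - E) * (sE * (1 - E * (q * x)) / (1 - E)) = sE * (1 - E * (q * x)) :=
        mul_div_cancel₀ _ hE0
      generalize sA * (1 - A * (q * x)) / (1 - A) = u at *
      generalize sE * (1 - E * (q * x)) / (1 - E) = v at *
      calc _ = ((1 - A) * u) * sB * sC * sD * (1 - C * x) * (q * x) / (sq * ((1 - E) * v) * sF * sG
            * ((1 - q * x) * (1 - F * x) * (1 - G * x))) := by
              simp only [div_eq_mul_inv, mul_inv]; ring
        _ = _ := by rw [hu, hv, hZ]; simp only [div_eq_mul_inv, mul_inv]; ring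
    have t2 : (1 - G / q) * (sA * sB * ((1 - C / q) * sC) * sD /
        (sq * (1 - q * x) * sE * (sF * (1 - F * x)) * ((1 - G / q) * sG)) * (q * x)) =
        Z * ((1 - C / q) * (1 - G * x) * (1 - E * (q * x)) * q * x) := by
      rw [hZ, mul_comm (1 - C / q) sC, ← mul_assoc, mul_div_assoc',
        div_mul_eq_mul_div, div_mul_eq_mul_div, div_eq_div_iff (by positivity) (by positivity)]
      ring
    have hH : sA * (1 - A * (q * x)) * (sB * (1 - B * (q * x))) * (sC * (1 - C * x)) *
        (sD * (1 - D * (q * x))) / (sq * (1 - q * x) * (sE * (1 - E * (q * x))) *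
        (sF * (1 - F * x)) * (sG * (1 - G * x))) =
        Z * ((1 - A * (q * x)) * (1 - B * (q * x)) * (1 - C * x) * (1 - D * (q * x))) := by
      rw [hZ]; ring
    rw [h0] at ih
    rw [hH]
    linear_combination ih + Z * key + (G / q - A) * (1 - F / (A * C)) * t0 +
      (E - B) * (1 - D / E) * t1 + (1 - F / C) * t2

/-- The polynomial identity behind `sum_phiTerm_step`; `y` is `q ^ k`. -/
lemma phi_step_identity {a c Q y : ℂ} (hc : c ≠ 0) (hQ : Q ≠ 0) :
    -((1 - Q) * (1 - a * Q / c) * (1 - Q ^ 2 * a) / Q) * (1 + Q * a / c * y) * (1 + c / Q * y) * y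
      - (1 + a * Q / c) * (1 + Q) * (1 - Q ^ 2 * a / c ^ 2) * (c / Q) * (1 - Q⁻¹ * y)
        * (1 - Q * a * y) * y
    = (1 + Q ^ 2 * a / c) * ((1 - a * y) * (1 - Q⁻¹ * y) * (1 - c * y) * (1 + Q * a / c * y)
      - (1 - y) * (1 - a / c * y) * (1 - Q * a * y) * (1 + c / Q * y)) := by
  field_simp
  ring

/-- A two-term recurrence for balanced series whose parameters are shifted by factors of `q`
telescopes as soon as the polynomial identity `key` in `y = q ^ k` holds. -/
lemma sum_phiTerm_telescope {q a c P D E f G U V K : ℂ}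
    (hqq : ∀ k : ℕ, 1 - q * q ^ k ≠ 0) (hEk : ∀ k : ℕ, 1 - E * q ^ k ≠ 0)
    (hFk : ∀ k : ℕ, 1 - q * f * q ^ k ≠ 0) (hGk : ∀ k : ℕ, 1 - G * q ^ k ≠ 0)
    (hP : 1 - P ≠ 0) (hD : 1 - D ≠ 0)
    (key : ∀ y, U * (1 - D * y) * (1 - G * y) * y - V * (1 - P * y) * (1 - E * y) * y =
      K * ((1 - a * y) * (1 - P * y) * (1 - c * y) * (1 - D * y)
        - (1 - y) * (1 - f * y) * (1 - E * y) * (1 - G * y))) (N : ℕ) :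
    U * ((1 - D) / (1 - E)) * ∑ k ∈ Finset.range (N + 1),
        phiTerm q a P c (q * D) (q * E) (q * f) G k
      - V * ((1 - P) / (1 - G)) * ∑ k ∈ Finset.range (N + 1),
        phiTerm q a (q * P) c D E (q * f) (q * G) k
    = K * (qShifted a q (N + 1) * qShifted P q (N + 1) * qShifted c q (N + 1) *
        qShifted D q (N + 1) / (qShifted q q N * qShifted E q (N + 1) *
        qShifted (q * f) q N * qShifted G q (N + 1))) := by
  have hE0 : 1 - E ≠ 0 := by simpa using hEk 0
  have hG0 : 1 - G ≠ 0 := by simpa using hGk 0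
  have shift : ∀ {x : ℂ}, 1 - x ≠ 0 → ∀ N : ℕ,
      (1 - x) * qShifted (q * x) q N = qShifted x q N * (1 - x * q ^ N) := by
    intro x hx N
    rw [← qShifted_succ, qShifted_succ']
  induction N with
  | zero =>
    have h := key 1
    simp only [zero_add, Finset.sum_range_one, phiTerm, qShifted_succ, qShifted_zero]
    simp only [pow_zero, mul_one, one_mul, div_one, sub_self, zero_mul, sub_zero] at h ⊢
    rw [← mul_div_assoc, ← mul_div_assoc, ← mul_div_assoc, div_sub_div _ _ hE0 hG0]
    congr 1
    linear_combination h
  | succ N ih =>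
    simp only [Finset.sum_range_succ _ (N + 1), mul_add]
    generalize ∑ k ∈ Finset.range (N + 1),
      phiTerm q a P c (q * D) (q * E) (q * f) G k = s0 at *
    generalize ∑ k ∈ Finset.range (N + 1),
      phiTerm q a (q * P) c D E (q * f) (q * G) k = s1 at *
    have key := key (q * q ^ N)
    have e1 := shift hP (N + 1)
    have e2 := shift hD (N + 1)
    have e3 := shift hE0 (N + 1)
    have e4 := shift hG0 (N + 1)
    have n1 := qShifted_ne_zero hqq N
    have n2 := qShifted_ne_zero hEk (N + 1)
    have n3 := qShifted_ne_zero hFk N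
    have n4 := qShifted_ne_zero hGk (N + 1)
    have m1 := hqq N
    have m2 := hEk (N + 1)
    have hF : 1 - q * f * q ^ N = 1 - f * (q * q ^ N) := by ring
    have m3 : 1 - f * (q * q ^ N) ≠ 0 := hF ▸ hFk N
    have m4 := hGk (N + 1)
    simp only [phiTerm, qShifted_succ _ q (N + 1), qShifted_succ q q N,
      qShifted_succ (q * f) q N, hF]
    simp only [pow_succ' q N] at *
    clear shift hqq hEk hFk hGk hF
    generalize qShifted a q (N + 1) = sa at *
    generalize qShifted P q (N + 1) = sP at *
    generalize qShifted c q (N + 1) = sc at *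
    generalize qShifted D q (N + 1) = sD at *
    generalize qShifted q q N = sq at *
    generalize qShifted E q (N + 1) = sE at *
    generalize qShifted (q * f) q N = sF at *
    generalize qShifted G q (N + 1) = sG at *
    generalize qShifted (q * P) q (N + 1) = sP' at *
    generalize qShifted (q * D) q (N + 1) = sD' at *
    generalize qShifted (q * E) q (N + 1) = sE' at *
    generalize qShifted (q * G) q (N + 1) = sG' at *
    generalize q * q ^ N = y at *
    have n3' : sE' ≠ 0 := fun h => mul_ne_zero n2 m2 (by rw [← e3, h, mul_zero])
    have n4' : sG' ≠ 0 := fun h => mul_ne_zero n4 m4 (by rw [← e4, h, mul_zero])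
    -- the common factor of the new terms and of the two products
    have hZ : ∃ Z : ℂ, Z = sa * sP * sc * sD /
      (sq * (1 - y) * (sE * (1 - E * y)) * (sF * (1 - f * y)) * (sG * (1 - G * y))) :=
      ⟨_, rfl⟩
    obtain ⟨Z, hZ⟩ := hZ
    have h0 : sa * sP * sc * sD / (sq * sE * sF * sG) =
        Z * ((1 - y) * (1 - E * y) * (1 - f * y) * (1 - G * y)) := by
      rw [hZ, div_mul_eq_mul_div, div_eq_div_iff (by positivity) (by positivity)]; ring
    have t1 : (1 - D) / (1 - E) * (sa * sP * sc * sD' / (sq * (1 - y) * sE' *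
        (sF * (1 - f * y)) * sG) * y) = Z * ((1 - D * y) * (1 - G * y) * y) := by
      calc _ = sa * sP * sc * ((1 - D) * sD') * y / (sq * ((1 - E) * sE') * sF * sG
            * ((1 - y) * (1 - f * y))) := by
              simp only [div_eq_mul_inv, mul_inv]; ring
        _ = _ := by
          rw [e2, e3, hZ, div_mul_eq_mul_div, div_eq_div_iff (by positivity) (by positivity)]; ring
    have t2 : (1 - P) / (1 - G) * (sa * sP' * sc * sD / (sq * (1 - y) * sE *
        (sF * (1 - f * y)) * sG') * y) = Z * ((1 - P * y) * (1 - E * y) * y) := by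
      calc _ = sa * ((1 - P) * sP') * sc * sD * y / (sq * sE * sF * ((1 - G) * sG')
            * ((1 - y) * (1 - f * y))) := by
              simp only [div_eq_mul_inv, mul_inv]; ring
        _ = _ := by
          rw [e1, e4, hZ, div_mul_eq_mul_div, div_eq_div_iff (by positivity) (by positivity)]; ring
    have hH : sa * (1 - a * y) * (sP * (1 - P * y)) * (sc * (1 - c * y)) *
        (sD * (1 - D * y)) / (sq * (1 - y) * (sE * (1 - E * y)) *
        (sF * (1 - f * y)) * (sG * (1 - G * y))) =
        Z * ((1 - a * y) * (1 - P * y) * (1 - c * y) * (1 - D * y)) := by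
      rw [hZ]; simp only [div_eq_mul_inv, mul_inv]; ring
    rw [h0] at ih
    rw [hH]
    linear_combination ih + Z * key + U * t1 - V * t2

/-- The recurrence in `n` for the series with `l = m = 0`; here `Q = q ^ (n + 1)`. -/
lemma sum_phiTerm_step {q a c Q : ℂ} (hc : c ≠ 0) (hQ : Q ≠ 0)
    (hqq : ∀ k : ℕ, 1 - q * q ^ k ≠ 0) (hEk : ∀ k : ℕ, 1 - Q * a * q ^ k ≠ 0)
    (hFk : ∀ k : ℕ, 1 - q * (a / c) * q ^ k ≠ 0) (hGk : ∀ k : ℕ, 1 - -(c / Q) * q ^ k ≠ 0)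
    (hP : 1 - Q⁻¹ ≠ 0) (hD : 1 - -(Q * a / c) ≠ 0) (N : ℕ) :
    -((1 - Q) * (1 - a * Q / c) * (1 - Q ^ 2 * a) / Q) * ((1 - -(Q * a / c)) / (1 - Q * a)) *
        ∑ k ∈ Finset.range (N + 1),
          phiTerm q a Q⁻¹ c (q * -(Q * a / c)) (q * (Q * a)) (q * (a / c)) (-(c / Q)) k
      - (1 + a * Q / c) * (1 + Q) * (1 - Q ^ 2 * a / c ^ 2) * (c / Q) *
        ((1 - Q⁻¹) / (1 - -(c / Q))) *
        ∑ k ∈ Finset.range (N + 1),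
          phiTerm q a (q * Q⁻¹) c (-(Q * a / c)) (Q * a) (q * (a / c)) (q * -(c / Q)) k
    = (1 + Q ^ 2 * a / c) * (qShifted a q (N + 1) * qShifted Q⁻¹ q (N + 1) * qShifted c q (N + 1) *
        qShifted (-(Q * a / c)) q (N + 1) / (qShifted q q N * qShifted (Q * a) q (N + 1) *
        qShifted (q * (a / c)) q N * qShifted (-(c / Q)) q (N + 1))) :=
  sum_phiTerm_telescope hqq hEk hFk hGk hP hD
    (fun y => by linear_combination phi_step_identity (a := a) (y := y) hc hQ) N

/-! ### Generic parameters -/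

/-- `q`, `a`, `c` are nonzero and multiplicatively independent, even up to signs. Then no factor
`1 ∓ q ^ u * a ^ v * c ^ w` vanishes, except for trivial reasons. -/
structure Generic (q a c : ℂ) : Prop where
  q_ne : q ≠ 0
  a_ne : a ≠ 0
  c_ne : c ≠ 0
  indep : ∀ u v w : ℤ, (q ^ u * a ^ v * c ^ w) ^ 2 = 1 → u = 0 ∧ v = 0 ∧ w = 0

namespace Generic

variable {q a c : ℂ}

lemma mul_left (h : Generic q a c) : Generic q (q * a) c where
  q_ne := h.q_ne
  a_ne := mul_ne_zero h.q_ne h.a_ne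
  c_ne := h.c_ne
  indep u v w e := by
    have := h.indep (u + v) v w (by rw [← e, zpow_add₀ h.q_ne, mul_zpow]; ring)
    omega

lemma div_right (h : Generic q a c) : Generic q a (c / q) where
  q_ne := h.q_ne
  a_ne := h.a_ne
  c_ne := div_ne_zero h.c_ne h.q_ne
  indep u v w e := by
    have := h.indep (u - w) v w (by rw [← e, zpow_sub₀ h.q_ne, div_zpow]; ring)
    omega

/-- The nonvanishing of `1 - x` for `x = ± (q^u a^v c^w) / (q^u' a^v' c^w')`. -/
lemma one_sub_ne (h : Generic q a c) {x : ℂ} (u v w u' v' w' : ℕ)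
    (hx : x ^ 2 * (q ^ u' * a ^ v' * c ^ w') ^ 2 = (q ^ u * a ^ v * c ^ w) ^ 2)
    (hne : u ≠ u' ∨ v ≠ v' ∨ w ≠ w') : 1 - x ≠ 0 := by
  intro h0
  have hq := h.q_ne
  have ha := h.a_ne
  have hc := h.c_ne
  have hx1 : x = 1 := by linear_combination -h0
  have := h.indep ((u : ℤ) - u') ((v : ℤ) - v') ((w : ℤ) - w') (by
    rw [hx1, one_pow, one_mul] at hx
    simp only [zpow_sub₀ hq, zpow_sub₀ ha, zpow_sub₀ hc, zpow_natCast]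
    have : q ^ u / q ^ u' * (a ^ v / a ^ v') * (c ^ w / c ^ w') =
      (q ^ u * a ^ v * c ^ w) / (q ^ u' * a ^ v' * c ^ w') := by
      simp only [div_eq_mul_inv, mul_inv]; ring
    rw [this, div_pow, ← hx, div_self]
    positivity)
  omega

lemma qk (h : Generic q a c) (k : ℕ) : 1 - q * q ^ k ≠ 0 :=
  h.one_sub_ne (k + 1) 0 0 0 0 0 (by ring) (by omega)

end Generic

/-! ### Recurrences for the terminating series -/

/-- The terminating series on the left-hand side, as a finite sum. -/
noncomputable def series (q a c : ℂ) (l m n : ℕ) : ℂ :=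
  ∑ k ∈ Finset.range (n + 1), phiTerm q a (q ^ n)⁻¹ c (-(q ^ (1 + l + m + n) * a / c))
    (q ^ (1 + m + n) * a) (q ^ (1 + l) * a / c) (-(c / q ^ n)) k

lemma qShifted_inv_pow_eq_zero {q : ℂ} (hq : q ≠ 0) {n k : ℕ} (h : n < k) :
    qShifted (q ^ n)⁻¹ q k = 0 :=
  Finset.prod_eq_zero (Finset.mem_range.2 h) (by
    rw [inv_mul_cancel₀ (pow_ne_zero _ hq), sub_self])

/-- `sum_phiTerm_contiguous` applied to the pairs `(a, q^{1+m+n} a)` and `(c, -q^{-n} c)`. -/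
lemma series_l_succ {q a c : ℂ} (h : Generic q a c) (l m n : ℕ) :
    c / q * (1 + q ^ (n + 1) * a / c) * (1 - q ^ (2 + l) / c ^ 2) * series q a c (l + 1) m n
      + (1 - q ^ (1 + m + 2 * n) * a) * (1 + q ^ (1 + l) / c) *
        ((1 - a) / (1 - q ^ (1 + m + n) * a)) * series q (q * a) c l m n
      - q ^ n * (1 - q ^ (2 + l) * a / c ^ 2) * (1 + c / q ^ (n + 1)) * series q a (c / q) l m n
      = 0 := by
  have hq := h.q_ne
  have ha := h.a_ne
  have hc := h.c_ne
  have hE : ∀ k : ℕ, 1 - q ^ (1 + m + n) * a * q ^ k ≠ 0 := fun k =>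
    h.one_sub_ne (1 + m + n + k) 1 0 0 0 0 (by ring) (by omega)
  have key := sum_phiTerm_contiguous (A := a) (B := (q ^ n)⁻¹) (C := c)
    (D := -(q ^ (2 + l + m + n) * a / c)) (E := q ^ (1 + m + n) * a) (F := q ^ (2 + l) * a / c)
    (G := -(c / q ^ n)) hq ha hc (by positivity)
    (h.one_sub_ne 0 1 0 0 0 0 (by ring) (by omega)) h.qk hE
    (fun k => h.one_sub_ne (2 + l + k) 1 0 0 0 1 (by field_simp; ring) (by omega))
    (fun k => h.one_sub_ne k 0 1 n 0 0 (by field_simp) (by omega))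
    (h.one_sub_ne 0 0 1 (n + 1) 0 0 (by field_simp; ring) (by omega))
    (by field_simp; ring) n
  rw [qShifted_inv_pow_eq_zero hq (Nat.lt_succ_self n)] at key
  have s0 : ∑ k ∈ Finset.range (n + 1), phiTerm q a (q ^ n)⁻¹ c (-(q ^ (2 + l + m + n) * a / c))
      (q ^ (1 + m + n) * a) (q ^ (2 + l) * a / c) (-(c / q ^ n)) k = series q a c (l + 1) m n := by
    simp only [series]
    rw [show 1 + (l + 1) + m + n = 2 + l + m + n by ring, show 1 + (l + 1) = 2 + l by ring]
  have s1 : ∑ k ∈ Finset.range (n + 1), phiTerm q (q * a) (q ^ n)⁻¹ c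
      (-(q ^ (2 + l + m + n) * a / c)) (q * (q ^ (1 + m + n) * a)) (q ^ (2 + l) * a / c)
      (-(c / q ^ n)) k = series q (q * a) c l m n := by
    simp only [series]
    rw [show q * (q ^ (1 + m + n) * a) = q ^ (1 + m + n) * (q * a) by ring,
      show q ^ (2 + l + m + n) * a / c = q ^ (1 + l + m + n) * (q * a) / c by ring,
      show q ^ (2 + l) * a / c = q ^ (1 + l) * (q * a) / c by ring]
  have s2 : ∑ k ∈ Finset.range (n + 1), phiTerm q a (q ^ n)⁻¹ (c / q)
      (-(q ^ (2 + l + m + n) * a / c)) (q ^ (1 + m + n) * a) (q ^ (2 + l) * a / c)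
      (-(c / q ^ n) / q) k = series q a (c / q) l m n := by
    simp only [series]
    rw [show -(c / q ^ n) / q = -(c / q / q ^ n) by ring,
      show q ^ (2 + l + m + n) * a / c = q ^ (1 + l + m + n) * a / (c / q) by field_simp; ring,
      show q ^ (2 + l) * a / c = q ^ (1 + l) * a / (c / q) by field_simp; ring]
  rw [s0, s1, s2] at key
  generalize series q a c (l + 1) m n = x0 at *
  generalize series q (q * a) c l m n = x1 at *
  generalize series q a (c / q) l m n = x2 at *
  simp only [mul_zero, zero_mul, zero_div] at key
  have c0 : (-(c / q ^ n) / q - a) * (1 - q ^ (2 + l) * a / c / (a * c)) * -(q ^ n) =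
      c / q * (1 + q ^ (n + 1) * a / c) * (1 - q ^ (2 + l) / c ^ 2) := by
    field_simp; ring
  have c1 : (q ^ (1 + m + n) * a - (q ^ n)⁻¹) *
      (1 - -(q ^ (2 + l + m + n) * a / c) / (q ^ (1 + m + n) * a)) * -(q ^ n) =
      (1 - q ^ (1 + m + 2 * n) * a) * (1 + q ^ (1 + l) / c) := by
    field_simp; ring
  have c2 : (1 - q ^ (2 + l) * a / c / c) * (1 - -(c / q ^ n) / q) * -(q ^ n) =
      -(q ^ n * (1 - q ^ (2 + l) * a / c ^ 2) * (1 + c / q ^ (n + 1))) := by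
    field_simp; ring
  rw [← c0, ← c1]
  linear_combination -q ^ n * key - x2 * c2

/-- `sum_phiTerm_contiguous` applied to the pairs `(a, q a / c)` and `(q^{-n}, -q^{-n} c)`. -/
lemma series_m_succ {q a c : ℂ} (h : Generic q a c) (m n : ℕ) :
    -(c / q ^ (n + 1) + a) * (1 - q ^ (2 + m + 2 * n)) * series q a c 0 (m + 1) n
      + (q * a / c - c) * (1 + q ^ (1 + m + n)) * ((1 - a) / (1 - q * a / c)) *
        series q (q * a) c 0 m n
      + (1 - q ^ (2 + m + 2 * n) * a) * (1 + c / q ^ (n + 1)) * series q a c 0 m (n + 1) = 0 := by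
  have hq := h.q_ne
  have ha := h.a_ne
  have hc := h.c_ne
  have hE : ∀ k : ℕ, 1 - q * a / c * q ^ k ≠ 0 := fun k =>
    h.one_sub_ne (1 + k) 1 0 0 0 1 (by field_simp; ring) (by omega)
  have key := sum_phiTerm_contiguous (A := a) (B := c) (C := (q ^ n)⁻¹)
    (D := -(q ^ (2 + m + n) * a / c)) (E := q * a / c) (F := q ^ (2 + m + n) * a)
    (G := -(c / q ^ n)) hq ha (by positivity) (by positivity)
    (h.one_sub_ne 0 1 0 0 0 0 (by ring) (by omega)) h.qk hE
    (fun k => h.one_sub_ne (2 + m + n + k) 1 0 0 0 0 (by ring) (by omega))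
    (fun k => h.one_sub_ne k 0 1 n 0 0 (by field_simp) (by omega))
    (h.one_sub_ne 0 0 1 (n + 1) 0 0 (by field_simp; ring) (by omega))
    (by field_simp) (n + 1)
  rw [qShifted_inv_pow_eq_zero hq (Nat.lt_succ_self n)] at key
  -- two of the series terminate one step before the third
  have z : ∀ A C D E F G : ℂ, phiTerm q A C (q ^ n)⁻¹ D E F G (n + 1) = 0 := by
    intros
    simp [phiTerm, qShifted_inv_pow_eq_zero hq (Nat.lt_succ_self n)]
  have swap : ∀ A B C D E F G : ℂ, ∀ k, phiTerm q A B C D E F G k = phiTerm q A C B D F E G k := by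
    intros
    simp only [phiTerm]; ring
  rw [Finset.sum_range_succ _ (n + 1), Finset.sum_range_succ _ (n + 1), z, z, add_zero,
    add_zero] at key
  simp only [swap _ c] at key
  have s0 : ∑ k ∈ Finset.range (n + 1), phiTerm q a (q ^ n)⁻¹ c (-(q ^ (2 + m + n) * a / c))
      (q ^ (2 + m + n) * a) (q * a / c) (-(c / q ^ n)) k = series q a c 0 (m + 1) n := by
    simp only [series]
    rw [show 1 + 0 + (m + 1) + n = 2 + m + n by ring, add_zero, pow_one]
  have s1 : ∑ k ∈ Finset.range (n + 1), phiTerm q (q * a) (q ^ n)⁻¹ c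
      (-(q ^ (2 + m + n) * a / c)) (q ^ (2 + m + n) * a) (q * (q * a / c))
      (-(c / q ^ n)) k = series q (q * a) c 0 m n := by
    simp only [series]
    rw [show q * (q * a / c) = q ^ (1 + 0) * (q * a) / c by ring,
      show q ^ (2 + m + n) * a / c = q ^ (1 + 0 + m + n) * (q * a) / c by ring,
      show q ^ (2 + m + n) * a = q ^ (1 + m + n) * (q * a) by ring]
  have s2 : ∑ k ∈ Finset.range (n + 1 + 1), phiTerm q a ((q ^ n)⁻¹ / q) c
      (-(q ^ (2 + m + n) * a / c)) (q ^ (2 + m + n) * a) (q * a / c)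
      (-(c / q ^ n) / q) k = series q a c 0 m (n + 1) := by
    simp only [series]
    rw [show -(c / q ^ n) / q = -(c / q ^ (n + 1)) by rw [neg_div, div_div, ← pow_succ],
      show (q ^ n)⁻¹ / q = (q ^ (n + 1))⁻¹ by rw [pow_succ, mul_inv]; rfl,
      show 1 + 0 + m + (n + 1) = 2 + m + n by ring, add_zero, pow_one]
  rw [s0, s1, s2] at key
  generalize series q a c 0 (m + 1) n = x0 at *
  generalize series q (q * a) c 0 m n = x1 at *
  generalize series q a c 0 m (n + 1) = x2 at *
  simp only [mul_zero, zero_mul, zero_div] at key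
  have c0 : (-(c / q ^ n) / q - a) * (1 - q ^ (2 + m + n) * a / (a * (q ^ n)⁻¹)) =
      -(c / q ^ (n + 1) + a) * (1 - q ^ (2 + m + 2 * n)) := by
    field_simp; ring
  have c1 : 1 - -(q ^ (2 + m + n) * a / c) / (q * a / c) = 1 + q ^ (1 + m + n) := by
    field_simp; ring
  have c2 : (1 - q ^ (2 + m + n) * a / (q ^ n)⁻¹) * (1 - -(c / q ^ n) / q) =
      (1 - q ^ (2 + m + 2 * n) * a) * (1 + c / q ^ (n + 1)) := by
    field_simp; ring
  rw [← c0, ← c1, ← c2]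
  linear_combination key

/-- For `l = m = 0` the series satisfies a first-order recurrence in `n`. -/
lemma series_n_succ {q a c : ℂ} (h : Generic q a c) (n : ℕ) :
    (1 - q ^ (n + 1) * a / c) * (1 - q ^ (2 * n + 2) * a) * (1 + q ^ (n + 1) / c) *
        series q a c 0 0 (n + 1)
      = (1 + q ^ (n + 1)) * (1 - q ^ (2 * n + 2) * a / c ^ 2) * (1 - q ^ (n + 1) * a) *
        series q a c 0 0 n := by
  have hq := h.q_ne
  have ha := h.a_ne
  have hc := h.c_ne
  have hE : ∀ k : ℕ, 1 - q ^ (n + 1) * a * q ^ k ≠ 0 := fun k =>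
      h.one_sub_ne (n + 1 + k) 1 0 0 0 0 (by ring) (by omega)
  have hD : 1 - -(q ^ (n + 1) * a / c) ≠ 0 :=
    h.one_sub_ne (n + 1) 1 0 0 0 1 (by field_simp) (by omega)
  have hG : ∀ k : ℕ, 1 - -(c / q ^ (n + 1)) * q ^ k ≠ 0 := fun k =>
    h.one_sub_ne k 0 1 (n + 1) 0 0 (by field_simp) (by omega)
  have hP : 1 - (q ^ (n + 1))⁻¹ ≠ 0 :=
    h.one_sub_ne 0 0 0 (n + 1) 0 0 (by field_simp) (by omega)
  have key := sum_phiTerm_step (Q := q ^ (n + 1)) (a := a) hc (by positivity) h.qk hE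
    (fun k => h.one_sub_ne (1 + k) 1 0 0 0 1 (by field_simp; ring) (by omega)) hG hP hD (n + 1)
  have hqP : q * (q ^ (n + 1))⁻¹ = (q ^ n)⁻¹ := by field_simp; ring
  rw [qShifted_inv_pow_eq_zero hq (Nat.lt_succ_self _), hqP] at key
  have z : ∀ A C D E F G : ℂ, phiTerm q A (q ^ n)⁻¹ C D E F G (n + 1) = 0 := by
    intros
    simp [phiTerm, qShifted_inv_pow_eq_zero hq (Nat.lt_succ_self n)]
  rw [Finset.sum_range_succ (phiTerm q a (q ^ n)⁻¹ c _ _ _ _) (n + 1), z, add_zero] at key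
  have s0 : ∑ k ∈ Finset.range (n + 1 + 1), phiTerm q a (q ^ (n + 1))⁻¹ c
      (q * -(q ^ (n + 1) * a / c)) (q * (q ^ (n + 1) * a)) (q * (a / c)) (-(c / q ^ (n + 1))) k
      = series q a c 0 0 (n + 1) := by
    simp only [series]
    rw [show q * -(q ^ (n + 1) * a / c) = -(q ^ (1 + 0 + 0 + (n + 1)) * a / c) by ring,
      show q * (q ^ (n + 1) * a) = q ^ (1 + 0 + (n + 1)) * a by ring,
      show q * (a / c) = q ^ (1 + 0) * a / c by ring]
  have s1 : ∑ k ∈ Finset.range (n + 1), phiTerm q a (q ^ n)⁻¹ c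
      (-(q ^ (n + 1) * a / c)) (q ^ (n + 1) * a) (q * (a / c)) (q * -(c / q ^ (n + 1))) k
      = series q a c 0 0 n := by
    simp only [series]
    rw [show -(q ^ (n + 1) * a / c) = -(q ^ (1 + 0 + 0 + n) * a / c) by ring,
      show q ^ (n + 1) * a = q ^ (1 + 0 + n) * a by ring,
      show q * (a / c) = q ^ (1 + 0) * a / c by ring,
      show q * -(c / q ^ (n + 1)) = -(c / q ^ n) by field_simp; ring]
  rw [s0, s1] at key
  generalize series q a c 0 0 (n + 1) = x0 at *
  generalize series q a c 0 0 n = x1 at *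
  simp only [mul_zero, zero_mul, zero_div] at key
  have hQ1 : 1 - q ^ (n + 1) ≠ 0 := by rw [pow_succ']; exact h.qk n
  have hQc : 1 + q ^ (n + 1) / c ≠ 0 := by
    have := h.one_sub_ne (x := -(q ^ (n + 1) / c)) (n + 1) 0 0 0 0 1 (by field_simp) (by omega)
    rwa [sub_neg_eq_add] at this
  have hE0 : 1 - q ^ (n + 1) * a ≠ 0 := by simpa using hE 0
  have hG0 : 1 - -(c / q ^ (n + 1)) ≠ 0 := by simpa using hG 0
  rw [show (2 * n + 2) = (n + 1) * 2 by ring, pow_mul]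
  have hQ : q ^ (n + 1) ≠ 0 := pow_ne_zero _ hq
  clear s0 s1 hE hG z hqP
  generalize q ^ (n + 1) = Q at *
  rw [sub_neg_eq_add] at *
  -- the common factor by which the two coefficients of `key` differ from those of the claim
  obtain ⟨κ, hκ⟩ : ∃ κ, κ = (1 - Q) * (1 + Q * a / c) / (Q * (1 - Q * a) * (1 + Q / c)) := ⟨_, rfl⟩
  have hκ0 : κ ≠ 0 := by rw [hκ]; positivity
  have c0 : (1 - Q) * (1 - a * Q / c) * (1 - Q ^ 2 * a) / Q * ((1 + Q * a / c) / (1 - Q * a)) =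
      κ * ((1 - Q * a / c) * (1 - Q ^ 2 * a) * (1 + Q / c)) := by
    rw [hκ, div_mul_div_comm, div_mul_eq_mul_div, div_eq_div_iff (by positivity) (by positivity)]
    ring
  have c1 : (1 + a * Q / c) * (1 + Q) * (1 - Q ^ 2 * a / c ^ 2) * (c / Q) *
      ((1 - Q⁻¹) / (1 + c / Q)) = -κ * ((1 + Q) * (1 - Q ^ 2 * a / c ^ 2) * (1 - Q * a)) := by
    have e1 : (1 - Q⁻¹) / (1 + c / Q) * (c / Q) * (1 + Q / c) = -(1 - Q) / Q := by
      have : (c / Q) * (1 + Q / c) = 1 + c / Q := by field_simp; ring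
      rw [mul_assoc, this, div_mul_cancel₀ _ hG0]; field_simp; ring
    have e2 : κ * (1 - Q * a) * (1 + Q / c) = (1 - Q) / Q * (1 + Q * a / c) := by
      rw [hκ, div_mul_eq_mul_div, div_mul_eq_mul_div, div_mul_eq_mul_div,
        div_eq_div_iff (by positivity) (by positivity)]
      ring
    apply mul_right_cancel₀ hQc
    linear_combination (1 + a * Q / c) * (1 + Q) * (1 - Q ^ 2 * a / c ^ 2) * e1 +
      (1 + Q) * (1 - Q ^ 2 * a / c ^ 2) * e2
  apply mul_left_cancel₀ hκ0
  linear_combination -key - x0 * c0 - x1 * c1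

/-! ### The coefficients of the expansion

The coefficients are indexed by pairs `(i, s)` with `i + s = l` and `(j, s)` with `j + s = m`, and all
shifted factorials in them are written with exponents that are nonnegative for every such pair. -/

/-- The products in base `q²` that occur in the sum of the series with `l = m = 0`. -/
noncomputable def evenProd (q a c : ℂ) (n : ℕ) : ℂ :=
  qShifted (q * a) (q ^ 2) n * qShifted (q ^ 2 * a / c ^ 2) (q ^ 2) n /
    (qShifted q (q ^ 2) n * qShifted (q ^ 2 * a ^ 2 / c ^ 2) (q ^ 2) n)

/-- The coefficient of `evenProd q (q ^ j * a) c (s + n)` in the expansion of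
`series q a c 0 (j + s) n`. -/
noncomputable def mCoef (q a c : ℂ) (j s n : ℕ) : ℂ :=
  (-q ^ (n + 1)) ^ j * qShifted q q (j + s) * qShifted q (q ^ 2) (s + n + 1) *
      qShifted (-q) q (j + s + n) * qShifted q q (s + 2 * n) * qShifted a q j *
      qShifted (q * a / c ^ 2) q j * qShifted (-(q * a / c)) q n /
    (qShifted q q j * qShifted q q s * qShifted q q (j + 2 * s + 2 * n + 1) *
      qShifted (q ^ 2 * a ^ 2 / c ^ 2) (q ^ 2) j * qShifted (q ^ (1 + j + s + n) * a) q n *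
      qShifted (-(q / c)) q n)

/-- The coefficient of the normalized series with parameters `q ^ s * a`, `c / q ^ i` and `l = 0`
in the expansion of the normalized `series q a c (i + s) m n`. -/
noncomputable def lCoef (q a c : ℂ) (i s : ℕ) : ℂ :=
  (-(q / c)) ^ (i + s) * (-(c / q)) ^ i * qShifted (-(q / c)) q (i + s) * qShifted q q (i + s) *
      qShifted a q s * qShifted (q ^ (1 + i + s) * a / c ^ 2) q i * qShifted (q / c ^ 2) q i *
      (1 - q ^ (1 + 2 * i) / c ^ 2) /
    (qShifted (-(q * a / c)) q (i + s) * qShifted q q i * qShifted q q s * (1 - q / c ^ 2) *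
      qShifted (q ^ 2 / c ^ 2) q (i + s + i))

/-- The normalizing factor of `series q a c l m n`: the second factor in front of the double sum,
without `(q ^ (1 + m + n); q)_n`. Relative to it, the expansion in `l` does not involve `m` and `n`. -/
noncomputable def normFactor (q a c : ℂ) (m n : ℕ) : ℂ :=
  qShifted (-(q * a / c)) q n / (qShifted (q ^ (1 + m + n) * a) q n * qShifted (-(q / c)) q n)

/-- If `f` satisfies a Pascal type recurrence on the antidiagonal `l + 1`, then its sum there splits
into the sums of the two parts over the antidiagonal `l`. -/
lemma sum_antidiagonal_pascal {f x y : ℕ → ℕ → ℂ} {l : ℕ} (hx : f 0 (l + 1) = x 0 l)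
    (hy : f (l + 1) 0 = y l 0)
    (hxy : ∀ i s, i + s + 1 = l → f (i + 1) (s + 1) = x (i + 1) s + y i (s + 1)) :
    ∑ p ∈ Finset.HasAntidiagonal.antidiagonal (l + 1), f p.1 p.2 =
      ∑ p ∈ Finset.HasAntidiagonal.antidiagonal l, x p.1 p.2 +
        ∑ p ∈ Finset.HasAntidiagonal.antidiagonal l, y p.1 p.2 := by
  cases l with
  | zero => simp [Finset.Nat.antidiagonal_succ, hx, hy]
  | succ l =>
    rw [Finset.Nat.sum_antidiagonal_succ, Finset.Nat.sum_antidiagonal_succ',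
      Finset.Nat.sum_antidiagonal_succ (f := fun p => x p.1 p.2),
      Finset.Nat.sum_antidiagonal_succ' (f := fun p => y p.1 p.2)]
    have : ∀ p ∈ Finset.HasAntidiagonal.antidiagonal l, f (p.1 + 1) (p.2 + 1) =
        x (p.1 + 1) p.2 + y p.1 (p.2 + 1) := fun p hp => hxy _ _ (by
      rw [Finset.HasAntidiagonal.mem_antidiagonal] at hp; omega)
    simp only [hx, hy]
    rw [Finset.sum_congr rfl this, Finset.sum_add_distrib]
    ring

namespace Generic
variable {q a c : ℂ}

lemma one_add_q (h : Generic q a c) (k : ℕ) : 1 - -q * q ^ k ≠ 0 :=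
  h.one_sub_ne (k + 1) 0 0 0 0 0 (by ring) (by omega)

lemma one_sub_a (h : Generic q a c) (u k : ℕ) : 1 - q ^ u * a * q ^ k ≠ 0 :=
  h.one_sub_ne (u + k) 1 0 0 0 0 (by ring) (by omega)

lemma one_add_ac (h : Generic q a c) (k : ℕ) : 1 - -(q * a / c) * q ^ k ≠ 0 :=
  h.one_sub_ne (k + 1) 1 0 0 0 1 (by have := h.c_ne; field_simp; ring) (by omega)

lemma one_sub_ac (h : Generic q a c) (k : ℕ) : 1 - q * a / c * q ^ k ≠ 0 :=
  h.one_sub_ne (k + 1) 1 0 0 0 1 (by have := h.c_ne; field_simp; ring) (by omega)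

lemma one_add_c (h : Generic q a c) (k : ℕ) : 1 - -(q / c) * q ^ k ≠ 0 :=
  h.one_sub_ne (k + 1) 0 0 0 0 1 (by have := h.c_ne; field_simp; ring) (by omega)

lemma one_sub_ac2 (h : Generic q a c) (u k : ℕ) : 1 - q ^ u * a / c ^ 2 * q ^ k ≠ 0 :=
  h.one_sub_ne (u + k) 1 0 0 0 2 (by have := h.c_ne; field_simp; ring) (by omega)

lemma one_sub_c2 (h : Generic q a c) (u k : ℕ) : 1 - q ^ u / c ^ 2 * q ^ k ≠ 0 :=
  h.one_sub_ne (u + k) 0 0 0 0 2 (by have := h.c_ne; field_simp; ring) (by omega)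

lemma one_sub_q_sq (h : Generic q a c) (k : ℕ) : 1 - q * (q ^ 2) ^ k ≠ 0 :=
  h.one_sub_ne (1 + 2 * k) 0 0 0 0 0 (by ring) (by omega)

lemma one_sub_a2c2 (h : Generic q a c) (k : ℕ) : 1 - q ^ 2 * a ^ 2 / c ^ 2 * (q ^ 2) ^ k ≠ 0 :=
  h.one_sub_ne (2 + 2 * k) 2 0 0 0 2 (by have := h.c_ne; field_simp; ring) (by omega)

end Generic

lemma mCoef_succ_right {q a c : ℂ} (h : Generic q a c) (j s n : ℕ) :
    mCoef q a c j s (n + 1) * ((1 - q ^ (j + s + 1)) * (1 - q ^ (2 + j + s + 2 * n) * a) *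
        (1 + q ^ (n + 1) / c)) =
      mCoef q a c j (s + 1) n * (q ^ j * (1 - q ^ (s + 1)) * (1 - q ^ (2 + s + 2 * n)) *
        (1 + q ^ (n + 1) * a / c)) := by
  have n1 := qShifted_ne_zero h.qk j
  have n2 := qShifted_ne_zero h.qk s
  have n3 := qShifted_ne_zero h.qk (j + 2 * s + 2 * (n + 1) + 1)
  have n4 := qShifted_ne_zero h.one_sub_a2c2 j
  have n5 := qShifted_ne_zero (h.one_sub_a (1 + j + s + (n + 1))) n
  have n6 := qShifted_ne_zero h.one_add_c n
  have m2 := h.qk s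
  have m5 := h.one_sub_a (1 + j + s + (n + 1)) n
  have m6 := h.one_add_c n
  simp only [mCoef]
  rw [show 1 + j + (s + 1) + n = 1 + j + s + (n + 1) by ring,
    show j + 2 * (s + 1) + 2 * n + 1 = j + 2 * s + 2 * (n + 1) + 1 by ring,
    show s + 1 + n + 1 = s + (n + 1) + 1 by ring, show j + (s + 1) + n = j + s + (n + 1) by ring,
    show s + 2 * (n + 1) = s + 1 + 2 * n + 1 by ring, ← add_assoc j s 1,
    qShifted_succ q q (j + s), qShifted_succ q q (s + 1 + 2 * n), qShifted_succ _ q n,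
    qShifted_succ _ q n, qShifted_succ _ q n, qShifted_succ q q s, neg_pow (q ^ (n + 1 + 1)),
    neg_pow (q ^ (n + 1)) j]
  rw [div_mul_eq_mul_div, div_mul_eq_mul_div, div_eq_div_iff (by positivity) (by positivity)]
  ring

lemma mCoef_succ_left {q a c : ℂ} (h : Generic q a c) (j s n : ℕ) :
    mCoef q (q * a) c j s n * (q ^ (n + 1) * (1 - q ^ (j + s + 1)) * (1 + q ^ (1 + j + s + n)) *
        (1 - a) * (1 - q * a / c ^ 2) * (1 + q * a / c)) =
      mCoef q a c (j + 1) s n * -((1 - q ^ (j + 1)) * (1 - q ^ (2 + j + 2 * s + 2 * n)) *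
        (1 + q ^ (n + 1) * a / c) * (1 - q ^ 2 * a ^ 2 / c ^ 2)) := by
  have n1 := qShifted_ne_zero h.qk j
  have n2 := qShifted_ne_zero h.qk s
  have n3 := qShifted_ne_zero h.qk (j + 2 * s + 2 * n + 1)
  have n4 := qShifted_ne_zero h.mul_left.one_sub_a2c2 j
  have n5 := qShifted_ne_zero (h.mul_left.one_sub_a (1 + j + s + n)) n
  have n6 := qShifted_ne_zero h.one_add_c n
  have m1 := h.qk j
  have m3 := h.qk (j + 2 * s + 2 * n + 1)
  have m4 : 1 - q ^ 2 * a ^ 2 / c ^ 2 ≠ 0 := by simpa using h.one_sub_a2c2 0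
  have e : qShifted (-(q * (q * a) / c)) q n * (1 + q * a / c) =
      qShifted (-(q * a / c)) q n * (1 + q ^ (n + 1) * a / c) := by
    have h1 := qShifted_succ (-(q * a / c)) q n
    rw [qShifted_succ', show q * -(q * a / c) = -(q * (q * a) / c) by ring] at h1
    linear_combination h1
  simp only [mCoef]
  rw [show q ^ (1 + (j + 1) + s + n) * a = q ^ (1 + j + s + n) * (q * a) by ring,
    show j + 1 + 2 * s + 2 * n + 1 = j + 2 * s + 2 * n + 1 + 1 by ring,
    show j + 1 + s + n = j + s + n + 1 by ring, show j + 1 + s = j + s + 1 by ring,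
    qShifted_succ q q (j + s), qShifted_succ q q (j + 2 * s + 2 * n + 1), qShifted_succ q q j,
    qShifted_succ (-q) q, qShifted_succ' a, qShifted_succ' (q * a / c ^ 2),
    qShifted_succ' (q ^ 2 * a ^ 2 / c ^ 2),
    show q * (q * a / c ^ 2) = q * (q * a) / c ^ 2 by ring,
    show q ^ 2 * (q ^ 2 * a ^ 2 / c ^ 2) = q ^ 2 * (q * a) ^ 2 / c ^ 2 by ring,
    neg_pow (q ^ (n + 1)), neg_pow (q ^ (n + 1))]
  rw [div_mul_eq_mul_div, div_mul_eq_mul_div,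
    div_eq_div_iff (by positivity) (by positivity),
    show 1 - q ^ (j + s + 1) = 1 - q * q ^ (j + s) by ring,
    show 1 - -q * q ^ (j + s + n) = 1 + q ^ (1 + j + s + n) by ring,
    show 1 - q ^ (j + 1) = 1 - q * q ^ j by ring,
    show 1 - q ^ (2 + j + 2 * s + 2 * n) = 1 - q * q ^ (j + 2 * s + 2 * n + 1) by ring]
  generalize 1 - q * q ^ (j + s) = b1 at *
  generalize 1 + q ^ (1 + j + s + n) = b2 at *
  generalize 1 - q * q ^ j = b3 at *
  generalize 1 - q * q ^ (j + 2 * s + 2 * n + 1) = b4 at *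
  generalize 1 - q * a / c ^ 2 = b5 at *
  generalize 1 - q ^ 2 * a ^ 2 / c ^ 2 = b6 at *
  generalize 1 + q * a / c = b7 at *
  generalize 1 + q ^ (n + 1) * a / c = b8 at *
  linear_combination ((-1) ^ j * (q ^ (n + 1)) ^ j * qShifted q q (j + s) *
    qShifted q (q ^ 2) (s + n + 1) * qShifted (-q) q (j + s + n) * qShifted q q (s + 2 * n) *
    qShifted (q * a) q j * qShifted (q * (q * a) / c ^ 2) q j *
    (q ^ (n + 1) * b1 * b2 * (1 - a) *
      b5) *
    (qShifted q q j * b3 * qShifted q q s *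
      (qShifted q q (j + 2 * s + 2 * n + 1) * b4) *
      (b6 * qShifted (q ^ 2 * (q * a) ^ 2 / c ^ 2) (q ^ 2) j) *
      qShifted (q ^ (1 + j + s + n) * (q * a)) q n * qShifted (-(q / c)) q n)) * e

lemma lCoef_succ_right {q a c : ℂ} (h : Generic q a c) (i s : ℕ) :
    lCoef q (q * a) c i s * ((1 + q ^ (1 + i + s) / c) * (1 - a) * (1 - q ^ (1 + i + s))) =
      lCoef q a c i (s + 1) * -(c / q * (1 + q * a / c) * (1 - q ^ (s + 1)) *
        (1 - q ^ (2 + i + s + i) / c ^ 2)) := by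
  have hq := h.q_ne
  have hc := h.c_ne
  have n1 := qShifted_ne_zero h.qk i
  have n2 := qShifted_ne_zero h.qk s
  have n3 := qShifted_ne_zero h.mul_left.one_add_ac (i + s)
  have n4 := qShifted_ne_zero (h.one_sub_c2 2) (i + s + i)
  have m1 := h.qk s
  have m2 : 1 - -(q * a / c) ≠ 0 := by simpa using h.one_add_ac 0
  have m3 : 1 - q / c ^ 2 ≠ 0 := by simpa using h.one_sub_c2 1 0
  have m4 := h.one_sub_c2 2 (i + s + i)
  simp only [lCoef]
  rw [show q ^ (1 + i + (s + 1)) * a / c ^ 2 = q ^ (1 + i + s) * (q * a) / c ^ 2 by ring,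
    show i + (s + 1) + i = i + s + i + 1 by ring, ← add_assoc i s 1,
    qShifted_succ q q (i + s), qShifted_succ (-(q / c)) q, qShifted_succ q q s,
    qShifted_succ' a, qShifted_succ' (-(q * a / c)),
    qShifted_succ (q ^ 2 / c ^ 2) q,
    show q * -(q * a / c) = -(q * (q * a) / c) by ring]
  rw [div_mul_eq_mul_div, div_mul_eq_mul_div, div_eq_div_iff (by positivity) (by positivity)]
  have e : (q / c) * (c / q) = 1 := by field_simp
  rw [pow_succ (-(q / c)), show 1 - -(q / c) * q ^ (i + s) = 1 + q ^ (1 + i + s) / c by ring,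
    show 1 - q ^ (1 + i + s) = 1 - q * q ^ (i + s) by ring,
    show 1 - q ^ (s + 1) = 1 - q * q ^ s by ring,
    show 1 - q ^ 2 / c ^ 2 * q ^ (i + s + i) = 1 - q ^ (2 + i + s + i) / c ^ 2 by ring,
    sub_neg_eq_add]
  generalize 1 + q ^ (1 + i + s) / c = b1 at *
  generalize 1 - q * q ^ (i + s) = b2 at *
  generalize 1 - q * q ^ s = b3 at *
  generalize 1 - q ^ (2 + i + s + i) / c ^ 2 = b4 at *
  generalize 1 + q * a / c = b5 at *
  generalize 1 - q ^ (1 + 2 * i) / c ^ 2 = b6 at *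
  generalize 1 - q / c ^ 2 = b7 at *
  generalize q / c = u at *
  generalize c / q = v at *
  linear_combination (-((-u) ^ (i + s) * (-v) ^ i *
    (qShifted (-u) q (i + s) * b1) *
    (qShifted q q (i + s) * b2) * ((1 - a) * qShifted (q * a) q s) *
    qShifted (q ^ (1 + i + s) * (q * a) / c ^ 2) q i * qShifted (q / c ^ 2) q i *
    b6 *
    (b5 * b3 * b4) *
    (qShifted (-(q * (q * a) / c)) q (i + s) * qShifted q q i * qShifted q q s * b7 *
      qShifted (q ^ 2 / c ^ 2) q (i + s + i)))) * e

lemma lCoef_succ_left {q a c : ℂ} (h : Generic q a c) (i s : ℕ) :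
    lCoef q a (c / q) i s * ((1 + q / c) * (1 - q ^ (2 + i + s) * a / c ^ 2) *
        (1 - q ^ (1 + i + s))) =
      lCoef q a c (i + 1) s * (q ^ s * (1 + q * a / c) * (1 - q ^ (i + 1)) *
        (1 - q ^ (2 + i) / c ^ 2)) := by
  have hq := h.q_ne
  have hc := h.c_ne
  have n1 := qShifted_ne_zero h.qk i
  have n2 := qShifted_ne_zero h.qk s
  have n3 := qShifted_ne_zero h.div_right.one_add_ac (i + s)
  have n4 := qShifted_ne_zero (h.div_right.one_sub_c2 2) (i + s + i)
  have m1 := h.qk i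
  have m2 : 1 - -(q * a / c) ≠ 0 := by simpa using h.one_add_ac 0
  have m3 : 1 - q / c ^ 2 ≠ 0 := by simpa using h.one_sub_c2 1 0
  have m4 : 1 - q ^ 2 / c ^ 2 ≠ 0 := by simpa using h.one_sub_c2 2 0
  have m5 : 1 - q ^ 3 / c ^ 2 ≠ 0 := by simpa using h.one_sub_c2 3 0
  have m6 : 1 - q / (c / q) ^ 2 ≠ 0 := by simpa using h.div_right.one_sub_c2 1 0
  have e1 : -(q / (c / q)) = q * -(q / c) := by field_simp
  have e2 : q ^ (1 + i + s) * a / (c / q) ^ 2 = q * (q ^ (2 + i + s) * a / c ^ 2) := by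
    field_simp; ring
  have e3 : q / (c / q) ^ 2 = q ^ 3 / c ^ 2 := by field_simp
  have e4 : q ^ (1 + 2 * i) / (c / q) ^ 2 = q ^ (3 + 2 * i) / c ^ 2 := by field_simp; ring
  have e5 : -(q * a / (c / q)) = q * -(q * a / c) := by field_simp
  have e6 : q ^ 2 / (c / q) ^ 2 = q * (q * (q ^ 2 / c ^ 2)) := by field_simp
  have e7 : (q * -(q / c)) ^ (i + s) * (-(c / q / q)) ^ i =
      (-(q / c)) ^ (i + s + 1) * (-(c / q)) ^ (i + 1) * q ^ s := by
    have h1 : (-(q / c)) * (-(c / q)) = 1 := by field_simp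
    have h2 : q ^ i * (q⁻¹) ^ i = 1 := by rw [← mul_pow, mul_inv_cancel₀ hq, one_pow]
    rw [show -(c / q / q) = -(c / q) * q⁻¹ by ring, mul_pow, mul_pow, pow_succ, pow_succ, pow_add q]
    linear_combination (q ^ s * (-(q / c)) ^ (i + s) * (-(c / q)) ^ i) * (h2 - h1)
  have e8 : qShifted (q ^ 2 / c ^ 2) q i * (1 - q ^ 2 / c ^ 2 * q ^ i) =
      (1 - q ^ 2 / c ^ 2) * qShifted (q ^ 3 / c ^ 2) q i := by
    rw [← qShifted_succ, qShifted_succ', show q * (q ^ 2 / c ^ 2) = q ^ 3 / c ^ 2 by ring]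
  rw [e6] at n4
  rw [e5] at n3
  rw [e3] at m6
  simp only [lCoef, e1, e2, e3, e4, e5, e6, e7]
  rw [show q ^ (1 + (i + 1) + s) * a / c ^ 2 = q ^ (2 + i + s) * a / c ^ 2 by ring,
    show i + 1 + s + (i + 1) = i + s + i + 1 + 1 by ring, show i + 1 + s = i + s + 1 by ring,
    qShifted_succ q q (i + s), qShifted_succ' (-(q / c)), qShifted_succ q q i,
    qShifted_succ' (q ^ (2 + i + s) * a / c ^ 2), qShifted_succ' (-(q * a / c)),
    qShifted_succ' (q / c ^ 2), qShifted_succ' (q ^ 2 / c ^ 2),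
    qShifted_succ' (q * (q ^ 2 / c ^ 2)), show q * (q / c ^ 2) = q ^ 2 / c ^ 2 by ring]
  have m5' : 1 - q * (q ^ 2 / c ^ 2) ≠ 0 := by convert m5 using 2; ring
  rw [div_mul_eq_mul_div, div_mul_eq_mul_div, div_eq_div_iff (by positivity) (by positivity)]
  rw [show 1 - q ^ (1 + i + s) = 1 - q * q ^ (i + s) by ring,
    show 1 - q ^ (i + 1) = 1 - q * q ^ i by ring,
    show 1 - q ^ (1 + 2 * (i + 1)) / c ^ 2 = 1 - q ^ (3 + 2 * i) / c ^ 2 by ring,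
    show 1 - q ^ (2 + i) / c ^ 2 = 1 - q ^ 2 / c ^ 2 * q ^ i by ring,
    show 1 - q ^ 3 / c ^ 2 = 1 - q * (q ^ 2 / c ^ 2) by ring, sub_neg_eq_add, sub_neg_eq_add]
  generalize 1 - q * q ^ (i + s) = b1 at *
  generalize 1 - q * q ^ i = b2 at *
  generalize 1 - q ^ (3 + 2 * i) / c ^ 2 = b3 at *
  generalize 1 - q ^ 2 / c ^ 2 * q ^ i = b4 at *
  generalize 1 - q ^ (2 + i + s) * a / c ^ 2 = b5 at *
  generalize 1 + q / c = b6 at *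
  generalize 1 + q * a / c = b7 at *
  generalize 1 - q / c ^ 2 = b8 at *
  generalize 1 - q * (q ^ 2 / c ^ 2) = b9 at *
  generalize 1 - q ^ 2 / c ^ 2 = b10 at *
  linear_combination (-((-(q / c)) ^ (i + s + 1) * (-(c / q)) ^ (i + 1) * q ^ s *
    qShifted (q * -(q / c)) q (i + s) * qShifted q q (i + s) * qShifted a q s *
    qShifted (q * (q ^ (2 + i + s) * a / c ^ 2)) q i * b3 *
    (b6 * b5 * b1) *
    b7 * qShifted (q * -(q * a / c)) q (i + s) *
    (qShifted q q i * b2) * qShifted q q s * b8 *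
    b9 * qShifted (q * (q * (q ^ 2 / c ^ 2))) q (i + s + i))) * e8

/-! ### The expansions -/

lemma normFactor_mul_left {q a c : ℂ} (h : Generic q a c) (m n : ℕ) :
    normFactor q (q * a) c m n * ((1 + q * a / c) * (1 - q ^ (1 + m + 2 * n) * a)) =
      normFactor q a c m n * ((1 + q ^ (n + 1) * a / c) * (1 - q ^ (1 + m + n) * a)) := by
  have n1 := qShifted_ne_zero (h.one_sub_a (1 + m + n)) n
  have n2 := qShifted_ne_zero (h.mul_left.one_sub_a (1 + m + n)) n
  have n3 := qShifted_ne_zero h.one_add_c n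
  have e : qShifted (-(q * (q * a) / c)) q n * (1 + q * a / c) =
      qShifted (-(q * a / c)) q n * (1 + q ^ (n + 1) * a / c) := by
    have h1 := qShifted_succ (-(q * a / c)) q n
    rw [qShifted_succ', show q * -(q * a / c) = -(q * (q * a) / c) by ring] at h1
    linear_combination h1
  have e2 : qShifted (q ^ (1 + m + n) * (q * a)) q n * (1 - q ^ (1 + m + n) * a) =
      qShifted (q ^ (1 + m + n) * a) q n * (1 - q ^ (1 + m + 2 * n) * a) := by
    have h1 := qShifted_succ (q ^ (1 + m + n) * a) q n
    rw [qShifted_succ', show q * (q ^ (1 + m + n) * a) = q ^ (1 + m + n) * (q * a) by ring] at h1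
    linear_combination h1
  simp only [normFactor]
  rw [div_mul_eq_mul_div, div_mul_eq_mul_div, div_eq_div_iff (by positivity) (by positivity)]
  linear_combination (1 - q ^ (1 + m + 2 * n) * a) * qShifted (q ^ (1 + m + n) * a) q n *
    qShifted (-(q / c)) q n * e - qShifted (-(q * a / c)) q n * (1 + q ^ (n + 1) * a / c) *
    qShifted (-(q / c)) q n * e2

lemma normFactor_div_right {q a c : ℂ} (h : Generic q a c) (m n : ℕ) :
    normFactor q a (c / q) m n * ((1 + q * a / c) * (1 + q ^ (n + 1) / c)) =
      normFactor q a c m n * ((1 + q ^ (n + 1) * a / c) * (1 + q / c)) := by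
  have n1 := qShifted_ne_zero (h.one_sub_a (1 + m + n)) n
  have n2 := qShifted_ne_zero h.div_right.one_add_c n
  have n3 := qShifted_ne_zero h.one_add_c n
  have e : qShifted (-(q * a / (c / q))) q n * (1 + q * a / c) =
      qShifted (-(q * a / c)) q n * (1 + q ^ (n + 1) * a / c) := by
    have h1 := qShifted_succ (-(q * a / c)) q n
    rw [qShifted_succ', show q * -(q * a / c) = -(q * a / (c / q)) by
      rw [div_div_eq_mul_div]; ring] at h1
    linear_combination h1
  have e2 : qShifted (-(q / (c / q))) q n * (1 + q / c) =
      qShifted (-(q / c)) q n * (1 + q ^ (n + 1) / c) := by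
    have h1 := qShifted_succ (-(q / c)) q n
    rw [qShifted_succ', show q * -(q / c) = -(q / (c / q)) by
      rw [div_div_eq_mul_div]; ring] at h1
    linear_combination h1
  simp only [normFactor]
  rw [div_mul_eq_mul_div, div_mul_eq_mul_div, div_eq_div_iff (by positivity) (by positivity)]
  linear_combination (1 + q ^ (n + 1) / c) * qShifted (q ^ (1 + m + n) * a) q n *
    qShifted (-(q / c)) q n * e - qShifted (-(q * a / c)) q n * (1 + q ^ (n + 1) * a / c) *
    qShifted (q ^ (1 + m + n) * a) q n * e2

lemma normFactor_ne_zero {q a c : ℂ} (h : Generic q a c) (m n : ℕ) : normFactor q a c m n ≠ 0 :=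
  div_ne_zero (qShifted_ne_zero h.one_add_ac n) (mul_ne_zero
    (qShifted_ne_zero (h.one_sub_a (1 + m + n)) n) (qShifted_ne_zero h.one_add_c n))

lemma mCoef_evenProd_succ {q a c : ℂ} (h : Generic q a c) (n : ℕ) :
    (1 - q ^ (n + 1) * a / c) * (1 - q ^ (2 * n + 2) * a) * (1 + q ^ (n + 1) / c) *
        (mCoef q a c 0 0 (n + 1) * evenProd q a c (n + 1))
      = (1 + q ^ (n + 1)) * (1 - q ^ (2 * n + 2) * a / c ^ 2) * (1 - q ^ (n + 1) * a) *
        (mCoef q a c 0 0 n * evenProd q a c n) := by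
  have n1 := qShifted_ne_zero h.qk (2 * n + 1)
  have n2 := qShifted_ne_zero (h.one_sub_a (1 + (n + 1))) n
  have n2' := qShifted_ne_zero (h.one_sub_a (1 + n)) n
  have n3 := qShifted_ne_zero h.one_add_c n
  have n4 := qShifted_ne_zero h.one_sub_q_sq n
  have n5 := qShifted_ne_zero h.one_sub_a2c2 n
  have m1 := h.qk (2 * n + 1)
  have m1' := h.qk (2 * n + 2)
  have m2 := h.one_sub_a (1 + (n + 1)) n
  have m3 := h.one_add_c n
  have m4 := h.one_sub_q_sq n
  have m5 := h.one_sub_a2c2 n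
  have e : qShifted (q ^ (1 + (n + 1)) * a) q n * (1 - q ^ (n + 1) * a) =
      qShifted (q ^ (1 + n) * a) q n * (1 - q ^ (2 * n + 1) * a) := by
    have h1 := qShifted_succ (q ^ (1 + n) * a) q n
    rw [qShifted_succ', show q * (q ^ (1 + n) * a) = q ^ (1 + (n + 1)) * a by ring] at h1
    linear_combination h1
  simp only [mCoef, evenProd, zero_add, mul_zero, add_zero, qShifted_zero, pow_zero, mul_one,
    one_mul]
  rw [show 2 * (n + 1) = 2 * n + 1 + 1 by ring, qShifted_succ q (q ^ 2) (n + 1),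
    qShifted_succ q (q ^ 2) n, qShifted_succ q q (2 * n + 1 + 1), qShifted_succ q q (2 * n + 1),
    qShifted_succ (-q) q, qShifted_succ (-(q * a / c)),
    qShifted_succ (q * a), qShifted_succ (q ^ 2 * a / c ^ 2), qShifted_succ (q ^ 2 * a ^ 2 / c ^ 2),
    qShifted_succ (q ^ (1 + (n + 1)) * a), qShifted_succ (-(q / c)), qShifted_succ q q (2 * n)]
  have n0 := qShifted_ne_zero h.qk (2 * n)
  have m0 := h.qk (2 * n)
  rw [show 1 - q * (q ^ 2) ^ (n + 1) = 1 - q * q ^ (2 * n + 1 + 1) by ring,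
    show 1 - q * (q ^ 2) ^ n = 1 - q * q ^ (2 * n) by ring,
    show 1 - q * a * (q ^ 2) ^ n = 1 - q ^ (2 * n + 1) * a by ring,
    show 1 - q ^ 2 * a / c ^ 2 * (q ^ 2) ^ n = 1 - q ^ (2 * n + 2) * a / c ^ 2 by ring,
    show 1 - q ^ 2 * a ^ 2 / c ^ 2 * (q ^ 2) ^ n =
      (1 - q ^ (n + 1) * a / c) * (1 + q ^ (n + 1) * a / c) by ring,
    show 1 - -(q * a / c) * q ^ n = 1 + q ^ (n + 1) * a / c by ring,
    show 1 - -(q / c) * q ^ n = 1 + q ^ (n + 1) / c by ring,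
    show 1 - q ^ (1 + (n + 1)) * a * q ^ n = 1 - q ^ (2 * n + 2) * a by ring,
    show 1 - -q * q ^ n = 1 + q ^ (n + 1) by ring] at *
  have m5' := left_ne_zero_of_mul m5
  have m5'' := right_ne_zero_of_mul m5
  rw [show 2 * n + 2 = 2 * n + 1 + 1 by ring] at *
  generalize 1 - q * q ^ (2 * n) = b1 at *
  generalize 1 - q * q ^ (2 * n + 1) = b2 at *
  generalize 1 - q * q ^ (2 * n + 1 + 1) = b3 at *
  generalize 1 - q ^ (2 * n + 1) * a = b4 at *
  generalize 1 - q ^ (2 * n + 1 + 1) * a / c ^ 2 = b5 at *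
  generalize 1 - q ^ (n + 1) * a / c = b6 at *
  generalize 1 + q ^ (n + 1) * a / c = b7 at *
  generalize 1 + q ^ (n + 1) / c = b8 at *
  generalize 1 - q ^ (2 * n + 1 + 1) * a = b9 at *
  generalize 1 - q ^ (n + 1) * a = b10 at *
  generalize qShifted (q ^ (1 + (n + 1)) * a) q n = z1 at *
  generalize qShifted (q ^ (1 + n) * a) q n = z2 at *
  generalize qShifted q (q ^ 2) n = z3 at *
  generalize qShifted q q (2 * n) = z4 at *
  generalize qShifted (q ^ 2 * a ^ 2 / c ^ 2) (q ^ 2) n = z5 at *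
  generalize qShifted (-(q / c)) q n = z6 at *
  rw [div_mul_div_comm, div_mul_div_comm, ← mul_div_assoc, ← mul_div_assoc,
    div_eq_div_iff (by positivity) (by positivity)]
  linear_combination (-(b6 * b9 * b8 * z3 * b1 ^ 3 * b3 * qShifted (-q) q n * (1 + q ^ (n + 1)) *
    z4 ^ 2 * b2 * qShifted (-(q * a / c)) q n * b7 * qShifted (q * a) (q ^ 2) n *
    qShifted (q ^ 2 * a / c ^ 2) (q ^ 2) n * b5 * z6 * z3 * z5)) * e

/-- The sum of the series with `l = m = 0`. -/
lemma series_zero_zero {q a c : ℂ} (h : Generic q a c) (n : ℕ) :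
    series q a c 0 0 n = mCoef q a c 0 0 n * evenProd q a c n := by
  induction n with
  | zero =>
    have : 1 - q ≠ 0 := by simpa using h.qk 0
    simp [series, mCoef, evenProd, phiTerm, qShifted_succ, qShifted_zero, this]
  | succ n ih =>
    have m1 : 1 - q ^ (n + 1) * a / c ≠ 0 := by
      convert h.one_sub_ac n using 2; ring
    have m2 : 1 - q ^ (2 * n + 2) * a ≠ 0 := by simpa using h.one_sub_a (2 * n + 2) 0
    have m3 : 1 + q ^ (n + 1) / c ≠ 0 := by
      convert h.one_add_c n using 1; ring
    apply mul_left_cancel₀ (mul_ne_zero (mul_ne_zero m1 m2) m3)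
    rw [series_n_succ h, ih, mCoef_evenProd_succ h]

/-- The expansion of the series with `l = 0`: both sides obey the recurrence `series_m_succ`, since
the coefficients obey the corresponding Pascal recurrence. -/
lemma series_zero_left {q a c : ℂ} (h : Generic q a c) (m n : ℕ) :
    series q a c 0 m n = ∑ p ∈ Finset.HasAntidiagonal.antidiagonal m,
      mCoef q a c p.1 p.2 n * evenProd q (q ^ p.1 * a) c (p.2 + n) := by
  induction m generalizing a n with
  | zero => simp [series_zero_zero h]
  | succ m ih =>
    have hc := h.c_ne
    have hq := h.q_ne
    have rec' := series_m_succ h m n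
    rw [ih h.mul_left n, ih h (n + 1)] at rec'
    have hD1 : 1 - q ^ (m + 1) ≠ 0 := by rw [pow_succ']; exact h.qk m
    have hD2 : 1 - q ^ (2 + m + 2 * n) ≠ 0 := by
      convert h.qk (1 + m + 2 * n) using 2; ring
    have hα : c / q ^ (n + 1) + a ≠ 0 := by
      have := h.one_sub_ne (x := -(q ^ (n + 1) * a / c)) (n + 1) 1 0 0 0 1 (by field_simp) (by omega)
      rw [show c / q ^ (n + 1) + a = c / q ^ (n + 1) * (1 - -(q ^ (n + 1) * a / c)) by
        field_simp; ring]
      exact mul_ne_zero (by positivity) this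
    have hac : 1 + q * a / c ≠ 0 := by simpa using h.one_add_ac 0
    have hac' : 1 - q * a / c ≠ 0 := by simpa using h.one_sub_ac 0
    have ha1 : 1 - a ≠ 0 := by simpa using h.one_sub_a 0 0
    have hac2 : 1 - q * a / c ^ 2 ≠ 0 := by simpa using h.one_sub_ac2 1 0
    -- the two halves of the recurrence, relative to the coefficient that they add up to
    have hx : ∀ j s, j + s = m →
        (1 - q ^ (2 + m + 2 * n) * a) * (1 + c / q ^ (n + 1)) * mCoef q a c j s (n + 1) *
          ((1 - q ^ (m + 1)) * (1 - q ^ (2 + m + 2 * n))) =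
        (c / q ^ (n + 1) + a) * (1 - q ^ (2 + m + 2 * n)) * mCoef q a c j (s + 1) n *
          (q ^ j * (1 - q ^ (s + 1)) * (1 - q ^ (2 + s + 2 * n))) := by
      rintro j s rfl
      have e1 : 1 + c / q ^ (n + 1) = c / q ^ (n + 1) * (1 + q ^ (n + 1) / c) := by
        field_simp; ring
      have e2 : c / q ^ (n + 1) + a = c / q ^ (n + 1) * (1 + q ^ (n + 1) * a / c) := by
        field_simp
      have := mCoef_succ_right h j s n
      rw [e1, e2, ← add_assoc 2 j s]
      linear_combination (c / q ^ (n + 1)) * (1 - q ^ (2 + j + s + 2 * n)) * this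
    have hy : ∀ j s, j + s = m →
        (q * a / c - c) * (1 + q ^ (1 + m + n)) * ((1 - a) / (1 - q * a / c)) *
          mCoef q (q * a) c j s n * ((1 - q ^ (m + 1)) * (1 - q ^ (2 + m + 2 * n))) =
        (c / q ^ (n + 1) + a) * (1 - q ^ (2 + m + 2 * n)) * mCoef q a c (j + 1) s n *
          ((1 - q ^ (j + 1)) * (1 - q ^ (2 + j + 2 * s + 2 * n))) := by
      rintro j s rfl
      have e2 : c / q ^ (n + 1) + a = c / q ^ (n + 1) * (1 + q ^ (n + 1) * a / c) := by
        field_simp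
      have e3 : (1 - a) / (1 - q * a / c) * (1 - q * a / c) = 1 - a := div_mul_cancel₀ _ hac'
      have e4 : q * a / c - c = -(c / q ^ (n + 1) * q ^ (n + 1)) * (1 - q * a / c ^ 2) := by
        field_simp; ring
      have e5 : 1 - q ^ 2 * a ^ 2 / c ^ 2 = (1 - q * a / c) * (1 + q * a / c) := by ring
      have this := mCoef_succ_left h j s n
      rw [e5] at this
      rw [e2, e4, ← add_assoc 2 j s, ← add_assoc 1 j s]
      apply mul_right_cancel₀ (mul_ne_zero hac' hac)
      clear hx ih rec' hα e2 e4 e5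
      generalize 1 - q * a / c ^ 2 = b1 at *
      generalize 1 + q ^ (1 + j + s + n) = b2 at *
      generalize 1 - q ^ (j + s + 1) = b3 at *
      generalize 1 - q ^ (2 + j + s + 2 * n) = b4 at *
      generalize 1 + q ^ (n + 1) * a / c = b5 at *
      generalize 1 - q * a / c = b6 at *
      generalize 1 + q * a / c = b7 at *
      generalize (1 - a) / b6 = b8 at *
      generalize c / q ^ (n + 1) = b9 at *
      linear_combination (-b9 * b4) * this - b9 * q ^ (n + 1) * b1 * b2 * b3 * b4 * b7 *
        mCoef q (q * a) c j s n * e3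
    apply mul_left_cancel₀ (mul_ne_zero hα hD2)
    have pascal := sum_antidiagonal_pascal (l := m)
      (f := fun j s => (c / q ^ (n + 1) + a) * (1 - q ^ (2 + m + 2 * n)) *
        (mCoef q a c j s n * evenProd q (q ^ j * a) c (s + n)))
      (x := fun j s => (1 - q ^ (2 + m + 2 * n) * a) * (1 + c / q ^ (n + 1)) *
        (mCoef q a c j s (n + 1) * evenProd q (q ^ j * a) c (s + (n + 1))))
      (y := fun j s => (q * a / c - c) * (1 + q ^ (1 + m + n)) * ((1 - a) / (1 - q * a / c)) *
        (mCoef q (q * a) c j s n * evenProd q (q ^ j * (q * a)) c (s + n)))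
      (by
        apply mul_right_cancel₀ (mul_ne_zero hD1 hD2)
        have := hx 0 m (by omega)
        rw [show m + 1 + n = m + (n + 1) by ring]
        linear_combination -(evenProd q (q ^ 0 * a) c (m + (n + 1))) * this)
      (by
        apply mul_right_cancel₀ (mul_ne_zero hD1 hD2)
        have := hy m 0 (by omega)
        rw [show q ^ (m + 1) * a = q ^ m * (q * a) by ring]
        linear_combination -(evenProd q (q ^ m * (q * a)) c (0 + n)) * this)
      (by
        rintro j s rfl
        apply mul_right_cancel₀ (mul_ne_zero hD1 hD2)
        have h1 := hx (j + 1) s (by omega)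
        have h2 := hy j (s + 1) (by omega)
        rw [show s + 1 + n = s + (n + 1) by ring, show q ^ j * (q * a) = q ^ (j + 1) * a by ring]
        linear_combination -(evenProd q (q ^ (j + 1) * a) c (s + (n + 1))) * (h1 + h2))
    simp only [← Finset.mul_sum] at pascal
    rw [pascal]
    linear_combination -rec'

/-- The expansion of the series in terms of series with `l = 0`, from `series_l_succ` and the Pascal
recurrence of `lCoef`. -/
lemma series_expand {q a c : ℂ} (h : Generic q a c) (l m n : ℕ) :
    series q a c l m n / normFactor q a c m n = ∑ p ∈ Finset.HasAntidiagonal.antidiagonal l,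
      lCoef q a c p.1 p.2 * (series q (q ^ p.2 * a) (c / q ^ p.1) 0 m n /
        normFactor q (q ^ p.2 * a) (c / q ^ p.1) m n) := by
  induction l generalizing a c with
  | zero =>
    have : 1 - q / c ^ 2 ≠ 0 := by simpa using h.one_sub_c2 1 0
    simp [lCoef, qShifted_zero, this]
  | succ l ih =>
    have hc := h.c_ne
    have hq := h.q_ne
    have ha1 : 1 - a ≠ 0 := by simpa using h.one_sub_a 0 0
    have hac : 1 + q * a / c ≠ 0 := by simpa using h.one_add_ac 0
    have hqc : 1 + q / c ≠ 0 := by simpa using h.one_add_c 0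
    have hD1 : 1 - q ^ (1 + l) ≠ 0 := by rw [add_comm, pow_succ']; exact h.qk l
    have hD2 : 1 - q ^ (2 + l) / c ^ 2 ≠ 0 := by simpa using h.one_sub_c2 (2 + l) 0
    -- the contiguous relation for the normalized series
    have rec' : c / q * (1 + q * a / c) * (1 - q ^ (2 + l) / c ^ 2) *
        (series q a c (l + 1) m n / normFactor q a c m n) =
        -((1 + q ^ (1 + l) / c) * (1 - a)) *
          (series q (q * a) c l m n / normFactor q (q * a) c m n) +
        c / q * (1 + q / c) * (1 - q ^ (2 + l) * a / c ^ 2) *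
          (series q a (c / q) l m n / normFactor q a (c / q) m n) := by
      have n0 := normFactor_ne_zero h m n
      have n1 := normFactor_ne_zero h.mul_left m n
      have n2 := normFactor_ne_zero h.div_right m n
      have r1 := normFactor_mul_left h m n
      have r2 := normFactor_div_right h m n
      have r0 := series_l_succ h l m n
      have k1 : 1 - q ^ (1 + m + n) * a ≠ 0 := by simpa using h.one_sub_a (1 + m + n) 0
      have k2 : 1 + q ^ (n + 1) * a / c ≠ 0 := by
        convert h.one_add_ac n using 1; ring
      have k3 : 1 + q ^ (n + 1) / c ≠ 0 := by
        convert h.one_add_c n using 1; ring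
      have e1 : q ^ n * (1 + c / q ^ (n + 1)) = c / q * (1 + q ^ (n + 1) / c) := by
        field_simp; ring
      obtain ⟨x0, hx0⟩ : ∃ x, x = series q a c (l + 1) m n / normFactor q a c m n := ⟨_, rfl⟩
      obtain ⟨x1, hx1⟩ : ∃ x, x = series q (q * a) c l m n / normFactor q (q * a) c m n := ⟨_, rfl⟩
      obtain ⟨x2, hx2⟩ : ∃ x, x = series q a (c / q) l m n / normFactor q a (c / q) m n := ⟨_, rfl⟩
      rw [← hx0, ← hx1, ← hx2]
      rw [eq_div_iff n0] at hx0
      rw [eq_div_iff n1] at hx1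
      rw [eq_div_iff n2] at hx2
      rw [← hx0, ← hx1, ← hx2] at r0
      have e3 : (1 - a) / (1 - q ^ (1 + m + n) * a) * (1 - q ^ (1 + m + n) * a) = 1 - a :=
        div_mul_cancel₀ _ k1
      apply mul_left_cancel₀ (mul_ne_zero k2 n0)
      linear_combination (1 + q * a / c) * r0 -
        ((1 + q ^ (1 + l) / c) * ((1 - a) / (1 - q ^ (1 + m + n) * a)) * x1) * r1 -
        ((1 + q ^ (1 + l) / c) * normFactor q a c m n * (1 + q ^ (n + 1) * a / c) * x1) * e3 +
        ((1 - q ^ (2 + l) * a / c ^ 2) * (c / q) * x2) * r2 +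
        ((1 - q ^ (2 + l) * a / c ^ 2) * x2 * normFactor q a (c / q) m n * (1 + q * a / c)) * e1
    rw [ih h.mul_left, ih h.div_right] at rec'
    have hx : ∀ i s, i + s = l →
        -((1 + q ^ (1 + l) / c) * (1 - a)) * lCoef q (q * a) c i s *
          ((1 - q ^ (1 + l)) * (1 - q ^ (2 + l) / c ^ 2)) =
        c / q * (1 + q * a / c) * (1 - q ^ (2 + l) / c ^ 2) * lCoef q a c i (s + 1) *
          ((1 - q ^ (s + 1)) * (1 - q ^ (2 + i + s + i) / c ^ 2)) := by
      rintro i s rfl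
      have := lCoef_succ_right h i s
      rw [← add_assoc 2 i s, ← add_assoc 1 i s]
      linear_combination -(1 - q ^ (2 + i + s) / c ^ 2) * this
    have hy : ∀ i s, i + s = l →
        c / q * (1 + q / c) * (1 - q ^ (2 + l) * a / c ^ 2) * lCoef q a (c / q) i s *
          ((1 - q ^ (1 + l)) * (1 - q ^ (2 + l) / c ^ 2)) =
        c / q * (1 + q * a / c) * (1 - q ^ (2 + l) / c ^ 2) * lCoef q a c (i + 1) s *
          (q ^ s * (1 - q ^ (i + 1)) * (1 - q ^ (2 + i) / c ^ 2)) := by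
      rintro i s rfl
      have := lCoef_succ_left h i s
      rw [← add_assoc 2 i s, ← add_assoc 1 i s]
      linear_combination (c / q) * (1 - q ^ (2 + i + s) / c ^ 2) * this
    obtain ⟨T, hT⟩ : ∃ T : ℂ → ℂ → ℂ, T = fun a c =>
      series q a c 0 m n / normFactor q a c m n := ⟨_, rfl⟩
    have hT' : ∀ a c, series q a c 0 m n / normFactor q a c m n = T a c := by simp [hT]
    simp only [hT'] at rec' ⊢
    have hα : c / q * (1 + q * a / c) * (1 - q ^ (2 + l) / c ^ 2) ≠ 0 := by positivity
    apply mul_left_cancel₀ hα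
    have pascal := sum_antidiagonal_pascal (l := l)
      (f := fun i s => c / q * (1 + q * a / c) * (1 - q ^ (2 + l) / c ^ 2) *
        (lCoef q a c i s * T (q ^ s * a) (c / q ^ i)))
      (x := fun i s => -((1 + q ^ (1 + l) / c) * (1 - a)) *
        (lCoef q (q * a) c i s * T (q ^ s * (q * a)) (c / q ^ i)))
      (y := fun i s => c / q * (1 + q / c) * (1 - q ^ (2 + l) * a / c ^ 2) *
        (lCoef q a (c / q) i s * T (q ^ s * a) (c / q / q ^ i)))
      (by
        apply mul_right_cancel₀ (mul_ne_zero hD1 hD2)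
        have := hx 0 l (by omega)
        rw [show q ^ (l + 1) * a = q ^ l * (q * a) by ring]
        linear_combination -(T (q ^ l * (q * a)) (c / q ^ 0)) * this)
      (by
        apply mul_right_cancel₀ (mul_ne_zero hD1 hD2)
        have := hy l 0 (by omega)
        rw [show c / q ^ (l + 1) = c / q / q ^ l by rw [pow_succ', div_div]]
        linear_combination -(T (q ^ 0 * a) (c / q / q ^ l)) * this)
      (by
        rintro i s rfl
        apply mul_right_cancel₀ (mul_ne_zero hD1 hD2)
        have h1 := hx (i + 1) s (by omega)
        have h2 := hy i (s + 1) (by omega)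
        rw [show q ^ (s + 1) * a = q ^ s * (q * a) by ring,
          show c / q ^ (i + 1) = c / q / q ^ i by rw [pow_succ', div_div]]
        linear_combination -(T (q ^ s * (q * a)) (c / q / q ^ i)) * (h1 + h2))
    simp only [← Finset.mul_sum] at pascal
    rw [pascal, ← rec']

/-! ### The coefficients as they occur in the double sum -/

lemma qShifted_mul_neg (x q : ℂ) (k : ℕ) :
    qShifted x q k * qShifted (-x) q k = qShifted (x ^ 2) (q ^ 2) k := by
  simp only [qShifted, ← Finset.prod_mul_distrib]
  exact Finset.prod_congr rfl fun i _ => by ring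

lemma qShifted_two_mul_add_one (q : ℂ) (k : ℕ) :
    qShifted q q (2 * k + 1) =
      qShifted q (q ^ 2) (k + 1) * (qShifted q q k * qShifted (-q) q k) := by
  rw [qShifted_mul_neg]
  induction k with
  | zero => simp [qShifted]
  | succ k ih =>
    rw [show 2 * (k + 1) + 1 = 2 * k + 1 + 1 + 1 by ring, qShifted_succ, qShifted_succ, ih,
      qShifted_succ q (q ^ 2) (k + 1), qShifted_succ (q ^ 2) (q ^ 2) k]
    ring

lemma lCoef_eq {q a c : ℂ} (h : Generic q a c) (i s : ℕ) :
    qFrac [a, -q ^ (-((i + s : ℕ) : ℤ)) * c]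
        [q ^ (-((i + s : ℕ) : ℤ) - 1) * c ^ 2, -q * a / c] q (i + s) *
      ((-1) ^ i * (c / a) ^ i * ((1 - q ^ (1 + 2 * i) / c ^ 2) / (1 - q / c ^ 2)) *
      qFrac [q ^ (-((i + s : ℕ) : ℤ)), q ^ (1 + (i + s)) * a / c ^ 2, q / c ^ 2]
        [q, q ^ (1 - ((i + s : ℕ) : ℤ)) / a, q ^ (2 + (i + s)) / c ^ 2] q i) =
    lCoef q a c i s := by
  have hq := h.q_ne
  have ha := h.a_ne
  have hc := h.c_ne
  obtain ⟨Y, hY⟩ : ∃ Y, Y = (q ^ (i + s))⁻¹ := ⟨_, rfl⟩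
  have hYq : Y * q ^ (i + s) = 1 := by rw [hY]; exact inv_mul_cancel₀ (pow_ne_zero _ hq)
  have hY0 : Y ≠ 0 := by rw [hY]; positivity
  have z1 : q ^ (-((i + s : ℕ) : ℤ)) = Y := by rw [zpow_neg, zpow_natCast, hY]
  have z2 : q ^ (-((i + s : ℕ) : ℤ) - 1) * c ^ 2 = Y * c ^ 2 / q := by
    rw [zpow_sub_one₀ hq, z1]; ring
  have z3 : q ^ (1 - ((i + s : ℕ) : ℤ)) / a = q * Y / a := by
    rw [sub_eq_add_neg, zpow_add₀ hq, z1, zpow_one]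
  have r1 := qShifted_reverse (x := q) (y := Y) (q := q) i s
    (by rw [add_comm s i]; linear_combination q * hYq) hq
  have r2 := qShifted_reverse (x := a) (y := q * Y / a) (q := q) i s
    (by rw [add_comm s i, div_mul_cancel₀ _ ha]; linear_combination q * hYq) hq
  have r3 := qShifted_reverse (x := -(q / c)) (y := -Y * c) (q := q) (i + s) 0
    (by
      rw [zero_add, show -Y * c * -(q / c) = Y * q * (c / c) by ring, div_self hc]
      linear_combination q * hYq) hq
  have r4 := qShifted_reverse (x := q ^ 2 / c ^ 2) (y := Y * c ^ 2 / q) (q := q) (i + s) 0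
    (by
      rw [zero_add, show Y * c ^ 2 / q * (q ^ 2 / c ^ 2) = Y * q by field_simp]
      linear_combination q * hYq) hq
  have r5 := qShifted_add (q ^ 2 / c ^ 2) q (i + s) i
  rw [qShifted_zero, mul_one, zero_add] at r3 r4
  have p1 : (-(-Y * c)) ^ (i + s) = (-(q / c)) ^ (i + s) * (-(Y * c ^ 2 / q)) ^ (i + s) := by
    rw [← mul_pow]; congr 1; field_simp
  have p2 : (-1) ^ i * (c / a) ^ i * (-Y) ^ i = (-(c / q)) ^ i * (-(q * Y / a)) ^ i := by
    rw [← mul_pow, ← mul_pow, ← mul_pow]; congr 1; field_simp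
  have n1 := qShifted_ne_zero h.qk i
  have n2 := qShifted_ne_zero h.qk s
  have n3 := qShifted_ne_zero h.one_add_ac (i + s)
  have n4 := qShifted_ne_zero (h.one_sub_c2 2) (i + s)
  have n5 := qShifted_ne_zero (h.one_sub_c2 (i + s + 2)) i
  have n6 : qShifted a q s ≠ 0 := by simpa using qShifted_ne_zero (h.one_sub_a 0) s
  have n7 : qShifted a q (i + s) ≠ 0 := by simpa using qShifted_ne_zero (h.one_sub_a 0) (i + s)
  have m1 : 1 - q / c ^ 2 ≠ 0 := by simpa using h.one_sub_c2 1 0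
  rw [add_comm s i] at r1 r2
  rw [← eq_div_iff n2] at r1
  rw [← eq_div_iff n6] at r2
  simp only [qFrac, lCoef, List.map_cons, List.map_nil, List.prod_cons, List.prod_nil, mul_one]
  rw [z1, z2, z3, r1, r2, r3, r4, r5, p1,
    show -q * a / c = -(q * a / c) by ring, show 1 + (i + s) = 1 + i + s by ring,
    show q ^ (i + s) * (q ^ 2 / c ^ 2) = q ^ (i + s + 2) / c ^ 2 by ring,
    show 2 + (i + s) = i + s + 2 by ring]
  have k1 : (-(q * Y / a)) ^ i ≠ 0 := pow_ne_zero _ (neg_ne_zero.2 (by positivity))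
  have k2 : (-(Y * c ^ 2 / q)) ^ (i + s) ≠ 0 :=
    pow_ne_zero _ (neg_ne_zero.2 (by positivity))
  have k3 : q ^ i.choose 2 ≠ 0 := by positivity
  have k4 : q ^ (i + s).choose 2 ≠ 0 := by positivity
  clear r1 r2 r3 r4 r5 p1 z1 z2 z3 hYq hY
  generalize (-(q * Y / a)) ^ i = P1 at *
  generalize (-(Y * c ^ 2 / q)) ^ (i + s) = P2 at *
  generalize (-(c / q)) ^ i = P3 at *
  generalize (-(q / c)) ^ (i + s) = P4 at *
  generalize (c / a) ^ i = P5 at *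
  generalize (-Y) ^ i = P6 at *
  generalize q ^ i.choose 2 = P7 at *
  generalize q ^ (i + s).choose 2 = P8 at *
  generalize 1 - q / c ^ 2 = b1 at *
  generalize 1 - q ^ (1 + 2 * i) / c ^ 2 = b2 at *
  generalize qShifted (q ^ 2 / c ^ 2) q (i + s) = s1 at *
  generalize qShifted (q ^ (i + s + 2) / c ^ 2) q i = s2 at *
  generalize qShifted (-(q * a / c)) q (i + s) = s3 at *
  field_simp
  linear_combination (P4 * qShifted (-(q / c)) q (i + s) * b2 * qShifted q q (i + s) *
    qShifted (q ^ (1 + i + s) * a / c ^ 2) q i * qShifted (q / c ^ 2) q i) * p2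

lemma mCoef_eq {q a c : ℂ} (h : Generic q a c) (j s n : ℕ) :
    qShifted (q ^ (1 + (j + s) + n)) q n * normFactor q a c (j + s) n *
      ((-1) ^ j * q ^ (((j + 1).choose 2 : ℤ) - (n : ℤ) * j) *
      qFrac [q ^ (-((j + s : ℕ) : ℤ)), q ^ (-((j + s : ℕ) : ℤ) - n),
          -q ^ (-((j + s : ℕ) : ℤ) - n), a, q * a / c ^ 2]
        [q, q * a / c, -(q * a / c), q ^ (-((j + s : ℕ) : ℤ) - 2 * n),
          q ^ ((j : ℤ) - 2 * (j + s : ℕ) - 2 * n - 1)] q j) =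
    mCoef q a c j s n := by
  have hq := h.q_ne
  have ha := h.a_ne
  have hc := h.c_ne
  have zp : ∀ (u : ℤ) (k : ℕ), u + 1 + k = 1 → q ^ u * q * q ^ k = q := by
    intro u k hu
    rw [← zpow_add_one₀ hq, ← zpow_natCast, ← zpow_add₀ hq, hu, zpow_one]
  have r1 := qShifted_reverse (x := q) (y := q ^ (-((j + s : ℕ) : ℤ))) (q := q) j s
    (zp _ _ (by push_cast; ring)) hq
  have r2 := qShifted_reverse (x := q) (y := q ^ (-((j + s : ℕ) : ℤ) - n)) (q := q) j (s + n)
    (zp _ _ (by push_cast; ring)) hq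
  have r3 := qShifted_reverse (x := -q) (y := -q ^ (-((j + s : ℕ) : ℤ) - n)) (q := q) j (s + n)
    (by rw [neg_mul_neg]; exact zp _ _ (by push_cast; ring)) hq
  have r4 := qShifted_reverse (x := q) (y := q ^ (-((j + s : ℕ) : ℤ) - 2 * n)) (q := q) j
    (s + 2 * n) (zp _ _ (by push_cast; ring)) hq
  have r5 := qShifted_reverse (x := q) (y := q ^ ((j : ℤ) - 2 * (j + s : ℕ) - 2 * n - 1)) (q := q) j
    (2 * (s + n) + 1) (zp _ _ (by push_cast; ring)) hq
  have r6 := qShifted_two_mul_add_one q (s + n)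
  have r7 := qShifted_mul_neg (q * a / c) q j
  have r8 := qShifted_add q q (j + s + n) n
  rw [neg_neg] at r3
  have pw : ∀ u : ℤ, (q ^ u) ^ j = q ^ (u * j) := fun u => by rw [zpow_mul, zpow_natCast]
  have hC : ((j + 1).choose 2 : ℤ) = j.choose 2 + j := by
    rw [Nat.choose_succ_succ' j 1, Nat.choose_one_right]; push_cast; ring
  have hC2 : (j : ℤ) * j = 2 * j.choose 2 + j := by
    have h3 := Nat.add_one_mul_choose_eq j 1
    rw [Nat.choose_one_right] at h3
    zify at h3
    rw [hC] at h3
    linarith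
  have p : (-1) ^ j * q ^ (((j + 1).choose 2 : ℤ) - (n : ℤ) * j) *
      (((-q ^ (-((j + s : ℕ) : ℤ))) ^ j * q ^ j.choose 2) *
      ((-q ^ (-((j + s : ℕ) : ℤ) - n)) ^ j * q ^ j.choose 2) *
      ((q ^ (-((j + s : ℕ) : ℤ) - n)) ^ j * q ^ j.choose 2)) = (-q ^ (n + 1)) ^ j *
      (((-q ^ (-((j + s : ℕ) : ℤ) - 2 * n)) ^ j * q ^ j.choose 2) *
      ((-q ^ ((j : ℤ) - 2 * (j + s : ℕ) - 2 * n - 1)) ^ j * q ^ j.choose 2)) := by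
    rw [neg_pow (q ^ _), neg_pow (q ^ _), neg_pow (q ^ _), neg_pow (q ^ _), neg_pow (q ^ _)]
    have hq1 : q ^ (n + 1) = q ^ ((n : ℤ) + 1) := by exact_mod_cast (zpow_natCast q (n + 1)).symm
    have hq2 : q ^ j.choose 2 = q ^ (j.choose 2 : ℤ) := (zpow_natCast q _).symm
    rw [hq1, hq2]
    simp only [pw]
    have e : q ^ (((j + 1).choose 2 : ℤ) - (n : ℤ) * j) *
        (q ^ (-((j + s : ℕ) : ℤ) * j) * q ^ (j.choose 2 : ℤ) *
        (q ^ ((-((j + s : ℕ) : ℤ) - n) * j) * q ^ (j.choose 2 : ℤ)) *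
        (q ^ ((-((j + s : ℕ) : ℤ) - n) * j) * q ^ (j.choose 2 : ℤ))) =
        q ^ (((n : ℤ) + 1) * j) * (q ^ ((-((j + s : ℕ) : ℤ) - 2 * n) * j) * q ^ (j.choose 2 : ℤ) *
        (q ^ (((j : ℤ) - 2 * (j + s : ℕ) - 2 * n - 1) * j) * q ^ (j.choose 2 : ℤ))) := by
      simp only [← zpow_add₀ hq]
      congr 1
      rw [hC]
      push_cast
      linear_combination -hC2
    linear_combination ((-1) ^ j) ^ 3 * e
  have n1 := qShifted_ne_zero h.qk j
  have n2 := qShifted_ne_zero h.qk s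
  have n3 := qShifted_ne_zero h.qk (s + n)
  have n4 := qShifted_ne_zero h.one_add_q (s + n)
  have n5 := qShifted_ne_zero h.qk (s + 2 * n)
  have n6 := qShifted_ne_zero h.one_sub_q_sq (s + n + 1)
  have n7 := qShifted_ne_zero h.qk (j + s + n)
  have n8 := qShifted_ne_zero (h.one_sub_a (1 + j + s + n)) n
  have n9 := qShifted_ne_zero h.one_add_c n
  have n10 := qShifted_ne_zero h.one_sub_ac j
  have n11 := qShifted_ne_zero h.one_add_ac j
  have n12 := qShifted_ne_zero h.qk (j + 2 * s + 2 * n + 1)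
  have n13 := qShifted_ne_zero h.qk (j + s + n + n)
  rw [show s + 2 * n + j = j + s + n + n by ring] at r4
  rw [show s + j = j + s by ring] at r1
  rw [show s + n + j = j + s + n by ring] at r2 r3
  rw [show 2 * (s + n) + 1 + j = j + 2 * s + 2 * n + 1 by ring, r6] at r5
  rw [← eq_div_iff n2] at r1
  rw [← eq_div_iff n3] at r2
  rw [← eq_div_iff n4] at r3
  rw [← eq_div_iff n5] at r4
  rw [← eq_div_iff (by positivity)] at r5
  rw [show q ^ (j + s + n) * q = q ^ (1 + j + s + n) by ring] at r8
  have r8' : qShifted (q ^ (1 + j + s + n)) q n = qShifted q q (j + s + n + n) /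
      qShifted q q (j + s + n) := by rw [eq_div_iff n7, r8]; ring
  simp only [qFrac, mCoef, normFactor, List.map_cons, List.map_nil, List.prod_cons, List.prod_nil,
    mul_one]
  rw [r1, r2, r3, r4, r5, show 1 + (j + s) + n = 1 + j + s + n by ring, r8',
    show q ^ 2 * a ^ 2 / c ^ 2 = (q * a / c) ^ 2 by ring, ← r7]
  have k0 : q ^ j.choose 2 ≠ 0 := by positivity
  have k1 : (-q ^ (-((j + s : ℕ) : ℤ) - 2 * n)) ^ j * q ^ j.choose 2 ≠ 0 :=
    mul_ne_zero (pow_ne_zero _ (neg_ne_zero.2 (zpow_ne_zero _ hq))) k0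
  have k2 : (-q ^ ((j : ℤ) - 2 * (j + s : ℕ) - 2 * n - 1)) ^ j * q ^ j.choose 2 ≠ 0 :=
    mul_ne_zero (pow_ne_zero _ (neg_ne_zero.2 (zpow_ne_zero _ hq))) k0
  clear r1 r2 r3 r4 r5 r6 r7 r8 r8' hC hC2 pw zp
  generalize (-q ^ (-((j + s : ℕ) : ℤ) - 2 * n)) ^ j * q ^ j.choose 2 = P1 at *
  generalize (-q ^ ((j : ℤ) - 2 * (j + s : ℕ) - 2 * n - 1)) ^ j * q ^ j.choose 2 = P2 at *
  generalize (-q ^ (-((j + s : ℕ) : ℤ))) ^ j * q ^ j.choose 2 = P3 at *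
  generalize (-q ^ (-((j + s : ℕ) : ℤ) - n)) ^ j * q ^ j.choose 2 = P4 at *
  generalize (q ^ (-((j + s : ℕ) : ℤ) - n)) ^ j * q ^ j.choose 2 = P5 at *
  generalize q ^ (((j + 1).choose 2 : ℤ) - (n : ℤ) * j) = P6 at *
  generalize (-q ^ (n + 1)) ^ j = P7 at *
  generalize qShifted q q j = s1 at *
  generalize qShifted q q s = s2 at *
  generalize qShifted q q (s + n) = s3 at *
  generalize qShifted (-q) q (s + n) = s4 at *
  generalize qShifted q q (s + 2 * n) = s5 at *
  generalize qShifted q (q ^ 2) (s + n + 1) = s6 at *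
  generalize qShifted q q (j + s + n) = s7 at *
  generalize qShifted (q ^ (1 + j + s + n) * a) q n = s8 at *
  generalize qShifted (-(q / c)) q n = s9 at *
  generalize qShifted (q * a / c) q j = s10 at *
  generalize qShifted (-(q * a / c)) q j = s11 at *
  generalize qShifted q q (j + 2 * s + 2 * n + 1) = s12 at *
  generalize qShifted q q (j + s + n + n) = s13 at *
  generalize qShifted (-(q * a / c)) q n = s14 at *
  generalize qShifted (q * a / c ^ 2) q j = s15 at *
  generalize qShifted q q (j + s) = s16 at *
  generalize qShifted (-q) q (j + s + n) = s17 at *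
  field_simp
  linear_combination (s14 * s16 * s17 * qShifted a q j * s15) * p

open Filter Topology

/-! ### The transformation for generic parameters -/

lemma qHypergeometric_eq_series {q : ℂ} (hq : q ≠ 0) (a c : ℂ) (l m n : ℕ) :
    qHypergeometric
        [a, c, q ^ (-(n : ℤ)), -q ^ (1 + l + m + n) * a / c]
        [q ^ (1 + l) * a / c, q ^ (1 + m + n) * a, -q ^ (-(n : ℤ)) * c] q q =
      series q a c l m n := by
  have e1 : q ^ (-(n : ℤ)) = (q ^ n)⁻¹ := by rw [zpow_neg, zpow_natCast]
  have e2 : -q ^ (1 + l + m + n) * a / c = -(q ^ (1 + l + m + n) * a / c) := by ring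
  have e3 : -(q ^ n)⁻¹ * c = -(c / q ^ n) := by ring
  rw [qHypergeometric, series, e1, e2, e3, tsum_eq_sum (s := Finset.range (n + 1))]
  · refine Finset.sum_congr rfl fun k _ => ?_
    simp only [qFrac, phiTerm, List.map_cons, List.map_nil, List.prod_cons, List.prod_nil, mul_one]
    ring
  · intro k hk
    rw [Finset.mem_range, not_lt] at hk
    simp [qFrac, qShifted_inv_pow_eq_zero hq (Nat.lt_of_succ_le hk)]

/-- The right-hand side of the transformation. -/
noncomputable def doubleSum (q a c : ℂ) (l m n : ℕ) : ℂ :=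
  qFrac [a, -q ^ (-(l : ℤ)) * c] [q ^ (-(l : ℤ) - 1) * c ^ 2, -q * a / c] q l
    * qFrac [q ^ (1 + m + n), -q * a / c] [q ^ (1 + m + n) * a, -q / c] q n
    * ∑ i ∈ Finset.range (l + 1), ∑ j ∈ Finset.range (m + 1),
        (-1) ^ (i + j) * q ^ (((j + 1).choose 2 : ℤ) - (n : ℤ) * j) * (c / a) ^ i
        * ((1 - q ^ (1 + 2 * i) / c ^ 2) / (1 - q / c ^ 2))
        * qFrac [q ^ (-(l : ℤ)), q ^ (1 + l) * a / c ^ 2, q / c ^ 2]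
            [q, q ^ (1 - (l : ℤ)) / a, q ^ (2 + l) / c ^ 2] q i
        * qFrac
            [q ^ (-(m : ℤ)), q ^ (-(m : ℤ) - n), -q ^ (-(m : ℤ) - n),
              q ^ ((l : ℤ) - i) * a, q ^ (1 + l + i) * a / c ^ 2]
            [q, q ^ (1 + l) * a / c, -q ^ (1 + l) * a / c,
              q ^ (-(m : ℤ) - 2 * n), q ^ ((j : ℤ) - 2 * m - 2 * n - 1)] q j
        * qFrac
            [q ^ (1 + (l : ℤ) - i + j) * a, q ^ (2 + l + i + j) * a / c ^ 2]
            [q, q ^ (2 + 2 * l + 2 * j) * a ^ 2 / c ^ 2] (q ^ 2) (m + n - j)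

namespace Generic

variable {q a c : ℂ}

lemma shift (h : Generic q a c) (i s : ℕ) : Generic q (q ^ s * a) (c / q ^ i) := by
  have h1 : Generic q (q ^ s * a) c := by
    induction s with
    | zero => simpa using h
    | succ s ih => rw [pow_succ', mul_assoc]; exact ih.mul_left
  induction i with
  | zero => simpa using h1
  | succ i ih => rw [pow_succ, ← div_div]; exact ih.div_right

end Generic

/-- The transformation for generic parameters. -/
lemma series_eq_doubleSum {q a c : ℂ} (h : Generic q a c) (l m n : ℕ) :
    series q a c l m n = doubleSum q a c l m n := by
  have hq := h.q_ne
  have ha := h.a_ne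
  have hc := h.c_ne
  have h0 := series_expand h l m n
  rw [div_eq_iff (normFactor_ne_zero h m n)] at h0
  rw [h0, doubleSum, Finset.Nat.sum_antidiagonal_eq_sum_range_succ_mk, Finset.sum_mul,
    Finset.mul_sum]
  refine Finset.sum_congr rfl fun i hi => ?_
  obtain ⟨s, rfl⟩ := Nat.exists_eq_add_of_le (Nat.lt_succ_iff.1 (Finset.mem_range.1 hi))
  rw [Nat.add_sub_cancel_left]
  have hg := h.shift i s
  rw [series_zero_left hg, Finset.Nat.sum_antidiagonal_eq_sum_range_succ_mk, Finset.sum_div,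
    Finset.mul_sum, Finset.sum_mul, Finset.mul_sum]
  refine Finset.sum_congr rfl fun j hj => ?_
  obtain ⟨t, rfl⟩ := Nat.exists_eq_add_of_le (Nat.lt_succ_iff.1 (Finset.mem_range.1 hj))
  rw [Nat.add_sub_cancel_left]
  have hN := normFactor_ne_zero hg (j + t) n
  have zs : ∀ (u : ℤ) (k : ℕ), u = k → q ^ u = q ^ k := by
    rintro u k rfl; exact zpow_natCast q k
  rw [← lCoef_eq h, ← mCoef_eq hg, mul_assoc (qShifted _ q n), mul_comm (normFactor _ _ _ _ n),
    zs (((i + s : ℕ) : ℤ) - i) s (by push_cast; ring),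
    zs (1 + ((i + s : ℕ) : ℤ) - i + j) (1 + s + j) (by push_cast; ring)]
  have f1 : qFrac [q ^ (1 + (j + t) + n), -q * a / c] [q ^ (1 + (j + t) + n) * a, -q / c] q n =
      qShifted (q ^ (1 + (j + t) + n)) q n * normFactor q a c (j + t) n := by
    simp only [qFrac, normFactor, List.map_cons, List.map_nil, List.prod_cons, List.prod_nil,
      mul_one]
    rw [show -q * a / c = -(q * a / c) by ring, show -q / c = -(q / c) by ring, mul_div_assoc]
  have f2 : evenProd q (q ^ j * (q ^ s * a)) (c / q ^ i) (t + n) =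
      qFrac [q ^ (1 + s + j) * a, q ^ (2 + (i + s) + i + j) * a / c ^ 2]
        [q, q ^ (2 + 2 * (i + s) + 2 * j) * a ^ 2 / c ^ 2] (q ^ 2) (j + t + n - j) := by
    simp only [qFrac, evenProd, List.map_cons, List.map_nil, List.prod_cons, List.prod_nil,
      mul_one]
    rw [show j + t + n - j = t + n by omega,
      show q * (q ^ j * (q ^ s * a)) = q ^ (1 + s + j) * a by ring,
      show q ^ 2 * (q ^ j * (q ^ s * a)) / (c / q ^ i) ^ 2 =
        q ^ (2 + (i + s) + i + j) * a / c ^ 2 by field_simp; ring,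
      show q ^ 2 * (q ^ j * (q ^ s * a)) ^ 2 / (c / q ^ i) ^ 2 =
        q ^ (2 + 2 * (i + s) + 2 * j) * a ^ 2 / c ^ 2 by field_simp; ring]
  have g1 : q * (q ^ s * a) / (c / q ^ i) ^ 2 = q ^ (1 + (i + s) + i) * a / c ^ 2 := by
    field_simp; ring
  have g2 : q * (q ^ s * a) / (c / q ^ i) = q ^ (1 + (i + s)) * a / c := by
    field_simp; ring
  rw [f1, f2, g1, g2, show -q ^ (1 + (i + s)) * a / c = -(q ^ (1 + (i + s)) * a / c) by ring]
  simp only [div_eq_mul_inv _ (normFactor q (q ^ s * a) (c / q ^ i) (j + t) n)]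
  have hNN := mul_inv_cancel₀ hN
  generalize normFactor q (q ^ s * a) (c / q ^ i) (j + t) n = N at *
  generalize qFrac [a, _] _ _ _ = F1
  generalize qFrac [_, q ^ (1 + (i + s)) * a / c ^ 2, q / c ^ 2] _ _ _ = F2
  generalize qFrac [_, _, _, q ^ s * a, _] _ _ _ = F3
  generalize qFrac [q ^ (1 + s + j) * a, _] _ _ _ = F4
  rw [pow_add]
  linear_combination (F1 * (-1) ^ i * (c / a) ^ i * ((1 - q ^ (1 + 2 * i) / c ^ 2) / (1 - q / c ^ 2)) *
    F2 * qShifted (q ^ (1 + (j + t) + n)) q n * (-1) ^ j *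
    q ^ (((j + 1).choose 2 : ℤ) - (n : ℤ) * j) * F3 * F4 * normFactor q a c (j + t) n) * hNN

/-! ### Passage from generic to arbitrary parameters -/

lemma countable_setOf_mul_zpow_sq_eq_one {ι : Type*} [Countable ι] (K : ι → ℂ) (w : ι → ℤ) :
    {z : ℂ | ∃ i, w i ≠ 0 ∧ (K i * z ^ w i) ^ 2 = 1}.Countable := by
  have nat : ∀ (K : ℂ) (w : ℕ), w ≠ 0 → {z : ℂ | (K * z ^ w) ^ 2 = 1}.Finite := by
    intro K w hw
    have hp : Polynomial.C (K ^ 2) * Polynomial.X ^ (2 * w) - 1 ≠ 0 := by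
      intro h
      have := congrArg (Polynomial.eval 0) h
      simp [hw] at this
    refine (Polynomial.finite_setOfPred_isRoot hp).subset fun z hz => ?_
    simp only [Set.mem_ofPred_eq, Polynomial.IsRoot, Polynomial.eval_sub, Polynomial.eval_mul,
      Polynomial.eval_C, Polynomial.eval_pow, Polynomial.eval_X, Polynomial.eval_one] at hz ⊢
    rw [← hz]; ring
  rw [show {z : ℂ | ∃ i, w i ≠ 0 ∧ (K i * z ^ w i) ^ 2 = 1} =
    ⋃ i, {z : ℂ | w i ≠ 0 ∧ (K i * z ^ w i) ^ 2 = 1} by ext; simp]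
  refine Set.countable_iUnion fun i => Set.Finite.countable ?_
  rcases eq_or_ne (w i) 0 with h0 | h0
  · simp [h0]
  obtain ⟨k, hk | hk⟩ := Int.eq_nat_or_neg (w i)
  · refine (nat (K i) k (by rintro rfl; simp [hk] at h0)).subset fun z hz => ?_
    have := hz.2
    rwa [hk, zpow_natCast] at this
  · refine (nat (K i)⁻¹ k (by rintro rfl; simp [hk] at h0)).subset fun z hz => ?_
    have := hz.2
    rw [hk, zpow_neg, zpow_natCast] at this
    have h2 := congrArg (·⁻¹) this
    simpa [mul_pow, mul_inv, inv_pow, mul_comm] using h2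

/-- Generic triples are dense. -/
lemma frequently_generic (q a c : ℂ) :
    ∃ᶠ p : ℂ × ℂ × ℂ in 𝓝 (q, a, c), Generic p.1 p.2.1 p.2.2 := by
  rw [frequently_iff]
  intro U hU
  obtain ⟨U₁, h₁, V, hV, hUV⟩ := mem_nhds_prod_iff.1 hU
  obtain ⟨U₂, h₂, U₃, h₃, hV'⟩ := mem_nhds_prod_iff.1 hV
  have pick : ∀ {S U : Set ℂ} {z : ℂ}, S.Countable → U ∈ 𝓝 z → ∃ x ∈ U, x ∉ S ∪ {0} := by
    intro S U z hS hz
    have hd : Dense (S ∪ {0})ᶜ := (hS.union (Set.countable_singleton 0)).dense_compl ℝ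
    obtain ⟨x, hx, hxU⟩ := mem_closure_iff_nhds.1 (hd z) U hz
    exact ⟨x, hx, hxU⟩
  obtain ⟨q', hq', bq⟩ := pick (countable_setOf_mul_zpow_sq_eq_one (fun _ : ℤ => 1) id) h₁
  obtain ⟨a', ha', ba⟩ := pick (countable_setOf_mul_zpow_sq_eq_one (fun p : ℤ × ℤ => q' ^ p.1) Prod.snd) h₂
  obtain ⟨c', hc', bc⟩ := pick (countable_setOf_mul_zpow_sq_eq_one (fun p : ℤ × ℤ × ℤ => q' ^ p.1 * a' ^ p.2.1)
    (fun p => p.2.2)) h₃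
  simp only [Set.mem_union, Set.mem_singleton_iff, not_or, Set.mem_ofPred_eq, not_exists,
    not_and, id] at bq ba bc
  refine ⟨(q', a', c'), hUV ⟨hq', hV' ⟨ha', hc'⟩⟩, bq.2, ba.2, bc.2, fun u v w e => ?_⟩
  have hw : w = 0 := by
    by_contra hw
    exact bc.1 (u, v, w) hw e
  subst hw
  have hv : v = 0 := by
    by_contra hv
    exact ba.1 (u, v) hv (by simpa using e)
  subst hv
  refine ⟨?_, rfl, rfl⟩
  by_contra hu
  exact bq.1 u hu (by simpa using e)

lemma qShifted_ne_zero_of_le {x q : ℂ} {k n : ℕ} (h : qShifted x q n ≠ 0) (hk : k ≤ n) :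
    qShifted x q k ≠ 0 := by
  obtain ⟨t, rfl⟩ := Nat.exists_eq_add_of_le hk
  rw [qShifted_add] at h
  exact left_ne_zero_of_mul h

@[fun_prop]
lemma ContinuousAt.qShifted {X : Type*} [TopologicalSpace X] {f g : X → ℂ} {p : X}
    (hf : ContinuousAt f p) (hg : ContinuousAt g p) (k : ℕ) :
    ContinuousAt (fun x => qShifted (f x) (g x) k) p := by
  unfold _root_.qShifted
  fun_prop

set_option maxHeartbeats 1000000 in
theorem theorem7 (q a c : ℂ) (l m n : ℕ)
    (hq : q ≠ 0) (ha : a ≠ 0) (hc : c ≠ 0)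
    -- no zero factor in the denominators of the series on the left (terms `0 ≤ k ≤ n`)
    (hL0 : qShifted q q n ≠ 0)
    (hL1 : qShifted (q ^ (1 + l) * a / c) q n ≠ 0)
    (hL2 : qShifted (q ^ (1 + m + n) * a) q n ≠ 0)
    (hL3 : qShifted (-q ^ (-(n : ℤ)) * c) q n ≠ 0)
    -- no zero factor in the denominators of the two fractions in front of the double sum
    (hP1 : qShifted (q ^ (-(l : ℤ) - 1) * c ^ 2) q l ≠ 0)
    (hP2 : qShifted (-q * a / c) q l ≠ 0)
    (hP3 : qShifted (-q / c) q n ≠ 0)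
    -- no zero factor in the denominators of the double sum (terms `0 ≤ i ≤ l`, `0 ≤ j ≤ m`)
    (hS0 : 1 - q / c ^ 2 ≠ 0)
    (hS1 : qShifted q q l ≠ 0)
    (hS2 : qShifted (q ^ (1 - (l : ℤ)) / a) q l ≠ 0)
    (hS3 : qShifted (q ^ (2 + l) / c ^ 2) q l ≠ 0)
    (hS4 : qShifted q q m ≠ 0)
    (hS5 : qShifted (q ^ (1 + l) * a / c) q m ≠ 0)
    (hS6 : qShifted (-q ^ (1 + l) * a / c) q m ≠ 0)
    (hS7 : qShifted (q ^ (-(m : ℤ) - 2 * n)) q m ≠ 0)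
    (hS8 : ∀ j ≤ m, qShifted (q ^ ((j : ℤ) - 2 * m - 2 * n - 1)) q j ≠ 0)
    (hS9 : qShifted q (q ^ 2) (m + n) ≠ 0)
    (hS10 : ∀ j ≤ m,
      qShifted (q ^ (2 + 2 * l + 2 * j) * a ^ 2 / c ^ 2) (q ^ 2) (m + n - j) ≠ 0) :
    qHypergeometric
        [a, c, q ^ (-(n : ℤ)), -q ^ (1 + l + m + n) * a / c]
        [q ^ (1 + l) * a / c, q ^ (1 + m + n) * a, -q ^ (-(n : ℤ)) * c] q q
      = qFrac [a, -q ^ (-(l : ℤ)) * c] [q ^ (-(l : ℤ) - 1) * c ^ 2, -q * a / c] q l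
        * qFrac [q ^ (1 + m + n), -q * a / c] [q ^ (1 + m + n) * a, -q / c] q n
        * ∑ i ∈ Finset.range (l + 1), ∑ j ∈ Finset.range (m + 1),
            (-1) ^ (i + j) * q ^ (((j + 1).choose 2 : ℤ) - (n : ℤ) * j) * (c / a) ^ i
            * ((1 - q ^ (1 + 2 * i) / c ^ 2) / (1 - q / c ^ 2))
            * qFrac [q ^ (-(l : ℤ)), q ^ (1 + l) * a / c ^ 2, q / c ^ 2]
                [q, q ^ (1 - (l : ℤ)) / a, q ^ (2 + l) / c ^ 2] q i
            * qFrac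
                [q ^ (-(m : ℤ)), q ^ (-(m : ℤ) - n), -q ^ (-(m : ℤ) - n),
                  q ^ ((l : ℤ) - i) * a, q ^ (1 + l + i) * a / c ^ 2]
                [q, q ^ (1 + l) * a / c, -q ^ (1 + l) * a / c,
                  q ^ (-(m : ℤ) - 2 * n), q ^ ((j : ℤ) - 2 * m - 2 * n - 1)] q j
            * qFrac
                [q ^ (1 + (l : ℤ) - i + j) * a, q ^ (2 + l + i + j) * a / c ^ 2]
                [q, q ^ (2 + 2 * l + 2 * j) * a ^ 2 / c ^ 2] (q ^ 2) (m + n - j) := by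
  rw [qHypergeometric_eq_series hq]
  have cont_series : ContinuousAt (fun p : ℂ × ℂ × ℂ => series p.1 p.2.1 p.2.2 l m n) (q, a, c) := by
    have h3 : qShifted (-(c / q ^ n)) q n ≠ 0 := by
      convert hL3 using 2
      rw [zpow_neg, zpow_natCast]; ring
    refine tendsto_finsetSum _ fun k hk => ?_
    have hk : k ≤ n := Nat.lt_succ_iff.1 (Finset.mem_range.1 hk)
    have n0 := qShifted_ne_zero_of_le hL0 hk
    have n1 := qShifted_ne_zero_of_le hL1 hk
    have n2 := qShifted_ne_zero_of_le hL2 hk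
    have n3 := qShifted_ne_zero_of_le h3 hk
    have hqn : q ^ n ≠ 0 := pow_ne_zero _ hq
    change ContinuousAt _ _
    unfold phiTerm
    refine ContinuousAt.mul (ContinuousAt.div ?_ ?_ (by positivity)) (by fun_prop)
    all_goals fun_prop (disch := assumption)
  have cont_doubleSum :
      ContinuousAt (fun p : ℂ × ℂ × ℂ => doubleSum p.1 p.2.1 p.2.2 l m n) (q, a, c) := by
    have hc2 : c ^ 2 ≠ 0 := pow_ne_zero _ hc
    have hz : ∀ (z : ℤ), ContinuousAt (fun p : ℂ × ℂ × ℂ => p.1 ^ z) (q, a, c) := fun z =>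
      ContinuousAt.zpow₀ (by fun_prop) z (Or.inl hq)
    unfold doubleSum
    simp only [qFrac, List.map_cons, List.map_nil, List.prod_cons, List.prod_nil, mul_one]
    refine ContinuousAt.mul (ContinuousAt.mul ?_ ?_) ?_
    · refine ContinuousAt.div ?_ ?_ (by positivity)
      all_goals fun_prop (disch := assumption)
    · refine ContinuousAt.div ?_ ?_ (by positivity)
      all_goals fun_prop (disch := assumption)
    · refine tendsto_finsetSum _ fun i hi => tendsto_finsetSum _ fun j hj => ?_
      have hi : i ≤ l := Nat.lt_succ_iff.1 (Finset.mem_range.1 hi)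
      have hj : j ≤ m := Nat.lt_succ_iff.1 (Finset.mem_range.1 hj)
      have n1 := qShifted_ne_zero_of_le hS1 hi
      have n2 := qShifted_ne_zero_of_le hS2 hi
      have n3 := qShifted_ne_zero_of_le hS3 hi
      have n4 := qShifted_ne_zero_of_le hS4 hj
      have n5 := qShifted_ne_zero_of_le hS5 hj
      have n6 := qShifted_ne_zero_of_le hS6 hj
      have n7 := qShifted_ne_zero_of_le hS7 hj
      have n8 := hS8 j hj
      have n9 := qShifted_ne_zero_of_le hS9 (Nat.sub_le (m + n) j)
      have n10 := hS10 j hj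
      change ContinuousAt _ _
      refine ContinuousAt.mul (ContinuousAt.mul (ContinuousAt.mul (ContinuousAt.mul
        (ContinuousAt.mul ?_ ?_) ?_) ?_) ?_) ?_
      · fun_prop (disch := assumption)
      · fun_prop (disch := assumption)
      · fun_prop (disch := assumption)
      · refine ContinuousAt.div ?_ ?_
          (mul_ne_zero n1 (mul_ne_zero n2 n3))
        all_goals fun_prop (disch := assumption)
      · refine ContinuousAt.div ?_ ?_
          (mul_ne_zero n4 (mul_ne_zero n5 (mul_ne_zero n6 (mul_ne_zero n7 n8))))
        all_goals fun_prop (disch := assumption)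
      · refine ContinuousAt.div ?_ ?_
          (mul_ne_zero n9 n10)
        all_goals fun_prop (disch := assumption)
  -- both sides are continuous at `(q, a, c)` and agree at generic points arbitrarily close to it
  have hfreq : ∃ᶠ p in 𝓝 (q, a, c), series p.1 p.2.1 p.2.2 l m n = doubleSum p.1 p.2.1 p.2.2 l m n :=
    (frequently_generic q a c).mono fun p hp => series_eq_doubleSum hp l m n
  by_contra hne
  exact hfreq ((cont_series.sub cont_doubleSum).eventually_ne (sub_ne_zero.2 hne) |>.mono
    fun p hp => sub_ne_zero.1 hp)
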